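/- **Setting.** Let $M\ge 0$, $N\ge 1$ be integers; $\rho_c,\rho_s,\rho_{\rm SI},\eta,\lambda,d_0,\mu>0$ and $w\in[0,1]$ be reals. Two transceivers $k\in\{A,B\}$ (write $k'$ for the other one) operate in two half-intervals $i\in\{1,2\}$; they have target angles $\theta_k\in\mathbb R$, reflection coefficients $\alpha_k\in\mathbb C$, channels $\mathbf h_k\in\mathbb C^M$ (from $k$ to $k'$) and self-interference channels $\mathbf g_k\in\mathbb C^M$. Let $\mathbf a(\theta)=\big(e^{j\frac{2\pi}{\lambda}md_0\sin\theta}\big)_{m=0}^{M-1}$ and $\dot{\mathbf a}=\partial\mathbf a/\partial\theta$. For $\mathbf w_{k,i}\in\mathbb C^M$ and Hermitian $\mathbf Q_{k,i}\in\mathbb C^{M\times M}$ put $$\Phi_{k,i}=\eta\,\mathbf g_k^H\mathbf Q_{k,i}\mathbf g_k,\quad B_{k,i}=\rho_{\rm SI}\Phi_{k,i}+1,\quad I_{k,i}=\rho_s\mathbf a^H(\theta_k)\mathbf Q_{k,i}\mathbf a(\theta_k)+B_{k,i},$$ $$\gamma_{k,i}=\frac{\rho_c|\mathbf h_{k'}^H\mathbf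 w_{k',i}|^2}{I_{k,i}},\quad G_{k,i}=|\alpha_k|^2\,\dot{\mathbf a}^H(\theta_k)\mathbf Q_{k,i}\dot{\mathbf a}(\theta_k),$$ $$R=\sum_k\tfrac12\sum_{i}\log_2(1+\gamma_{k,i}),\qquad C=\sum_k\frac1{2\rho_sN}\Big(\sum_i\frac{G_{k,i}}{B_{k,i}}\Big)^{-1}.$$ **Problem (P).** Maximize $wR-(1-w)\mu C$ (read as $R$ when $w=1$) over $\{\mathbf w_{k,i},\mathbf Q_{k,i}\}$ subject to $\sum_i\mathrm{tr}(\mathbf Q_{k,i})\le2$ for all $k$, $\mathbf Q_{k,i}\succeq\mathbf w_{k,i}\mathbf w_{k,i}^H$ for all $k,i$, and the mode constraint: either full-duplex, $\mathbf Q_{k,1}=\mathbf Q_{k,2}$ for both $k$; or half-duplex, $\mathbf Q_{A,2}=\mathbf Q_{B,1}=\mathbf 0$. **Algorithm.** Start at $\{\mathbf w^{[0]}_{k,i},\mathbf Q^{[0]}_{k,i},g^{[0]}_{k,i}\}$ with $(\mathbf w^{[0]},\mathbf Q^{[0]})$ feasible for (P), $(g^{[0]}_{k,i})^2\le G^{[0]}_{k,i}$,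 $g^{[0]}_{k,i}\ge0$, and $g^{[0]}_{k,i}>0$ whenever $k$ transmits in interval $i$ (always in full-duplex mode; only for $(A,1)$ and $(B,2)$ in half-duplex mode). For every $t\ge0$ let $\{\mathbf w^{[t+1]},\mathbf Q^{[t+1]},g^{[t+1]}\}$ be the corresponding part of a global maximizer of the convex problem $$\max_{\mathbf w,\mathbf Q,r,g,d}\ \frac w2\sum_{k,i}\log_2(1+r_{k,i})-\frac{(1-w)\mu}{2\rho_sN}\sum_k\Big(\sum_id_{k,i}\Big)^{-1}$$ subject to, for all $k,i$, $r_{k,i}\ge0$; $g_{k,i},d_{k,i}\ge0$, with strict inequality whenever $k$ transmits in interval $i$; $G_{k,i}\ge g_{k,i}^2$; $$\frac{2\rho_c\,\mathrm{Re}\{(\mathbf w^{[t]}_{k',i})^H\mathbf h_{k'}\mathbf h_{k'}^H\mathbf w_{k',i}\}}{I^{[t]}_{k,i}}-\rho_c\Big|\frac{\mathbf h_{k'}^H\mathbf w^{[t]}_{k',i}}{I^{[t]}_{k,i}}\Big|^2I_{k,i}\ \ge\ r_{k,i},\qquad \frac{2g^{[t]}_{k,i}}{B^{[t]}_{k,i}}g_{k,i}-\Big(\frac{g^{[t]}_{k,i}}{B^{[t]}_{k,i}}\Big)^2B_{k,i}\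 \ge\ d_{k,i};$$ $\begin{bmatrix}\mathbf Q_{k,i}&\mathbf w_{k,i}\\ \mathbf w_{k,i}^H&1\end{bmatrix}\succeq0$; the power constraints; and the mode constraint. (Superscript $[t]$ denotes the value at the $t$-th iterate.) **Proposition.** In either mode, if $(\mathbf w^{[t]}_{k,i},\mathbf Q^{[t]}_{k,i})\to(\mathbf w^{[\infty]}_{k,i},\mathbf Q^{[\infty]}_{k,i})$ as $t\to\infty$, then the limit is a KKT point of (P): it is feasible; if $w<1$, then $\sum_iG_{k,i}/B_{k,i}>0$ there for both $k$, so that the objective is defined; and there are $\lambda_k\ge0$, $\mathbf\Upsilon_{k,i}\succeq0$ and Hermitian $\mathbf V_k$ such that the Lagrangian $$-\big(wR-(1-w)\mu C\big)+\sum_k\lambda_k\Big(\sum_i\mathrm{tr}(\mathbf Q_{k,i})-2\Big)-\sum_{k,i}\mathrm{tr}\big(\mathbf\Upsilon_{k,i}(\mathbf Q_{k,i}-\mathbf w_{k,i}\mathbf w_{k,i}^H)\big)+\sum_k\mathrm{tr}(\mathbf V_k\mathbf E_k)$$ has zero gradient in $(\mathbf w,\mathbf Q)$ at the limit, where $\mathbf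 E_k=\mathbf Q_{k,1}-\mathbf Q_{k,2}$ in full-duplex mode and $\mathbf E_A=\mathbf Q_{A,2}$, $\mathbf E_B=\mathbf Q_{B,1}$ in half-duplex mode, and such that $\lambda_k(\sum_i\mathrm{tr}(\mathbf Q_{k,i})-2)=0$ and $\mathrm{tr}(\mathbf\Upsilon_{k,i}(\mathbf Q_{k,i}-\mathbf w_{k,i}\mathbf w_{k,i}^H))=0$ there for all $k,i$. -/

import Mathlib

open Filter Topology
open scoped Matrix ComplexOrder

attribute [local instance] Matrix.normedAddCommGroup Matrix.normedSpace

noncomputable section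

/-- The two duplex modes of the bidirectional system. -/
inductive DuplexMode where
  | full
  | half

/-- Parameters of a narrowband bidirectional ISAC system with `M` transmit antennas per transceiver.
The transceivers `A`, `B` are `0, 1 : Fin 2`; the two halves of the processing interval are also
indexed by `Fin 2`. -/
structure ISACSystem (M : ℕ) where
  /-- number of symbols in each half of the coherent processing interval -/
  N : ℕ
  /-- SNR of the communication signal -/
  rhoC : ℝ
  /-- SNR of the sensing echo -/
  rhoS : ℝ
  /-- residual self-interference factor (receiver dynamic range) -/
  rhoSI : ℝ
  /-- interference-to-noise ratio of the self-interference -/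
  eta : ℝ
  /-- signal wavelength -/
  wavelength : ℝ
  /-- antenna spacing -/
  spacing : ℝ
  /-- target angles -/
  theta : Fin 2 → ℝ
  /-- complex reflection coefficients -/
  alpha : Fin 2 → ℂ
  /-- communication channel from transceiver `k` to the other one -/
  h : Fin 2 → Fin M → ℂ
  /-- self-interference channel at transceiver `k` -/
  gSI : Fin 2 → Fin M → ℂ
  /-- weight between communication and sensing -/
  weight : ℝ
  /-- scaling of the CRB relative to the rate -/
  mu : ℝ
  N_pos : 0 < N
  rhoC_pos : 0 < rhoC
  rhoS_pos : 0 < rhoS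
  rhoSI_pos : 0 < rhoSI
  eta_pos : 0 < eta
  wavelength_pos : 0 < wavelength
  spacing_pos : 0 < spacing
  weight_nonneg : 0 ≤ weight
  weight_le_one : weight ≤ 1
  mu_pos : 0 < mu

/-- The design variables `(w, Q)`: beamformers `w k i` and transmit covariances `Q k i`, for
transceiver `k` and half-interval `i`. -/
abbrev Design (M : ℕ) : Type :=
  (Fin 2 → Fin 2 → Fin M → ℂ) × (Fin 2 → Fin 2 → Matrix (Fin M) (Fin M) ℂ)

/-- `vᴴ Q v` (real for Hermitian `Q`). -/
def hermQuad {M : ℕ} (v : Fin M → ℂ) (Q : Matrix (Fin M) (Fin M) ℂ) : ℝ :=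
  (star v ⬝ᵥ (Q *ᵥ v)).re

namespace ISACSystem

variable {M : ℕ} (S : ISACSystem M)

/-- Steering vector of a uniform linear array, as a function of the angle. -/
def steering (θ : ℝ) : Fin M → ℂ := fun m =>
  Complex.exp (Complex.I *
    ((2 * Real.pi / S.wavelength * (m : ℝ) * S.spacing * Real.sin θ : ℝ) : ℂ))

/-- Derivative of the steering vector with respect to the angle. -/
def steeringDot (θ : ℝ) : Fin M → ℂ := fun m => deriv (fun ϑ : ℝ => S.steering ϑ m) θ

/-- `Φ_{k,i} = η g_kᴴ Q_{k,i} g_k`. -/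
def Phi (x : Design M) (k i : Fin 2) : ℝ := S.eta * hermQuad (S.gSI k) (x.2 k i)

/-- Residual self-interference plus noise power `ρ_SI Φ_{k,i} + 1`. -/
def siNoise (x : Design M) (k i : Fin 2) : ℝ := S.rhoSI * S.Phi x k i + 1

/-- `I_{k,i} = ρ_s aᴴ Q_{k,i} a + ρ_SI Φ_{k,i} + 1`. -/
def interf (x : Design M) (k i : Fin 2) : ℝ :=
  S.rhoS * hermQuad (S.steering (S.theta k)) (x.2 k i) + S.rhoSI * S.Phi x k i + 1

/-- `h_{k'}ᴴ w_{k',i}`, where `k'` is the transceiver other than `k`. -/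
def signal (x : Design M) (k i : Fin 2) : ℂ := star (S.h k.rev) ⬝ᵥ x.1 k.rev i

/-- The SINR `γ_{k,i}`. -/
def sinr (x : Design M) (k i : Fin 2) : ℝ := S.rhoC * ‖S.signal x k i‖ ^ 2 / S.interf x k i

/-- The achievable rate `R_k`. -/
def rate (x : Design M) (k : Fin 2) : ℝ := 1 / 2 * ∑ i, Real.logb 2 (1 + S.sinr x k i)

/-- `G_{k,i} = |α_k|² ȧᴴ Q_{k,i} ȧ`. -/
def sensGain (x : Design M) (k i : Fin 2) : ℝ :=
  ‖S.alpha k‖ ^ 2 * hermQuad (S.steeringDot (S.theta k)) (x.2 k i)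

/-- `∑_i |α_k|² ȧᴴ Q_{k,i} ȧ / (ρ_SI Φ_{k,i} + 1)`, the normalized Fisher information. -/
def sensInfo (x : Design M) (k : Fin 2) : ℝ := ∑ i, S.sensGain x k i / S.siNoise x k i

/-- The Cramér–Rao bound `C_k`. -/
def crb (x : Design M) (k : Fin 2) : ℝ := 1 / (2 * S.rhoS * S.N) * (S.sensInfo x k)⁻¹

/-- The weighted-sum objective `w R - (1 - w) μ C`. -/
def objective (x : Design M) : ℝ :=
  S.weight * ∑ k, S.rate x k - (1 - S.weight) * S.mu * ∑ k, S.crb x k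

end ISACSystem

/-- The matrix which the duplex mode forces to vanish for transceiver `k`:
`Q_{k,1} - Q_{k,2}` in full duplex; `Q_{A,2}` resp. `Q_{B,1}` in half duplex. -/
def modeResidual {M : ℕ} (m : DuplexMode) (x : Design M) (k : Fin 2) : Matrix (Fin M) (Fin M) ℂ :=
  match m with
  | .full => x.2 k 0 - x.2 k 1
  | .half => x.2 k k.rev

/-- The duplex mode constraint. -/
def ModeConstraint {M : ℕ} (m : DuplexMode) (x : Design M) : Prop := ∀ k, modeResidual m x k = 0

/-- The half-intervals in which transceiver `k` transmits. -/
def Transmits (m : DuplexMode) (k i : Fin 2) : Prop :=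
  match m with
  | .full => True
  | .half => i = k

/-- `∑_i tr Q_{k,i} - 2`. -/
def powerExcess {M : ℕ} (x : Design M) (k : Fin 2) : ℝ := (∑ i, (x.2 k i).trace).re - 2

/-- `Q_{k,i} - w_{k,i} w_{k,i}ᴴ`. -/
def sensCov {M : ℕ} (x : Design M) (k i : Fin 2) : Matrix (Fin M) (Fin M) ℂ :=
  x.2 k i - Matrix.vecMulVec (x.1 k i) (star (x.1 k i))

/-- The block matrix `[Q_{k,i}, w_{k,i}; w_{k,i}ᴴ, 1]`. -/
def schurBlock {M : ℕ} (x : Design M) (k i : Fin 2) :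
    Matrix (Fin M ⊕ Unit) (Fin M ⊕ Unit) ℂ :=
  Matrix.fromBlocks (x.2 k i) (Matrix.replicateCol Unit (x.1 k i))
    (Matrix.replicateCol Unit (x.1 k i))ᴴ 1

/-- Feasibility for the weighted-sum problem: mode, average power, `Q_{k,i} ⪰ w_{k,i} w_{k,i}ᴴ`. -/
structure IsFeasible {M : ℕ} (m : DuplexMode) (x : Design M) : Prop where
  mode : ModeConstraint m x
  power : ∀ k, powerExcess x k ≤ 0
  psd : ∀ k i, (sensCov x k i).PosSemidef

namespace ISACSystem

variable {M : ℕ} (S : ISACSystem M)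

/-- Lagrangian of the weighted-sum problem (written as minimization of `-objective`), with
multipliers `lam k` of the power constraints, `U k i` of `Q_{k,i} ⪰ w_{k,i} w_{k,i}ᴴ`, and `V k` of
the mode constraints. -/
def lagrangian (m : DuplexMode) (lam : Fin 2 → ℝ)
    (U : Fin 2 → Fin 2 → Matrix (Fin M) (Fin M) ℂ) (V : Fin 2 → Matrix (Fin M) (Fin M) ℂ)
    (x : Design M) : ℝ :=
  -S.objective x + ∑ k, lam k * powerExcess x k
    - ∑ k, ∑ i, (U k i * sensCov x k i).trace.re
    + ∑ k, (V k * modeResidual m x k).trace.re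

/-- `x` is a KKT point of the weighted-sum problem: it is feasible, the objective is well defined at
`x` (for `weight = 1` the CRB does not enter the objective), and multipliers exist for which dual
feasibility, stationarity (in the real variables underlying `w` and `Q`) and complementary
slackness hold. -/
structure IsKKTPoint (m : DuplexMode) (x : Design M) : Prop where
  feasible : IsFeasible m x
  objective_defined : S.weight < 1 → ∀ k, 0 < S.sensInfo x k
  multipliers : ∃ (lam : Fin 2 → ℝ) (U : Fin 2 → Fin 2 → Matrix (Fin M) (Fin M) ℂ)
      (V : Fin 2 → Matrix (Fin M) (Fin M) ℂ),
    (∀ k, 0 ≤ lam k) ∧ (∀ k i, (U k i).PosSemidef) ∧ (∀ k, (V k).IsHermitian) ∧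
    HasFDerivAt (S.lagrangian m lam U V) (0 : Design M →L[ℝ] ℝ) x ∧
    (∀ k, lam k * powerExcess x k = 0) ∧
    (∀ k i, (U k i * sensCov x k i).trace = 0)

/-- Surrogate `γ_{k,i}^{[t]}` of the SINR, built at `y` and evaluated at `x`. -/
def sinrSurrogate (y x : Design M) (k i : Fin 2) : ℝ :=
  2 * S.rhoC * (star (S.signal y k i) * S.signal x k i).re / S.interf y k i
    - S.rhoC * ‖S.signal y k i / (S.interf y k i : ℂ)‖ ^ 2 * S.interf x k i

/-- Surrogate `D_{k,i}^{[t]}` of `g_{k,i}² / (ρ_SI Φ_{k,i} + 1)`, built at `(y, gy)` and evaluated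
at `(x, g)`. -/
def sensSurrogate (y : Design M) (gy : Fin 2 → Fin 2 → ℝ) (x : Design M) (g : Fin 2 → Fin 2 → ℝ)
    (k i : Fin 2) : ℝ :=
  2 * gy k i / S.siNoise y k i * g k i - (gy k i / S.siNoise y k i) ^ 2 * S.siNoise x k i

/-- The objective `f(w, r, d)` of the reformulated problem. -/
def auxObjective (r d : Fin 2 → Fin 2 → ℝ) : ℝ :=
  S.weight / 2 * ∑ k, ∑ i, Real.logb 2 (1 + r k i)
    - (1 - S.weight) * S.mu / (2 * S.rhoS * S.N) * ∑ k, (∑ i, d k i)⁻¹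

end ISACSystem

/-- Sign condition on the sensing auxiliary variables `g`, `d`: positive in the half-intervals in
which the transceiver transmits. In an idle half-interval `Q_{k,i} = 0` leaves only the value `0`,
hence nonnegativity there. -/
def AuxSign (m : DuplexMode) (g : Fin 2 → Fin 2 → ℝ) : Prop :=
  ∀ k i, 0 ≤ g k i ∧ (Transmits m k i → 0 < g k i)

/-- A point `(w, Q, r, g, d)` of the convex subproblem. -/
structure SubPoint (M : ℕ) where
  x : Design M
  r : Fin 2 → Fin 2 → ℝ
  g : Fin 2 → Fin 2 → ℝ
  d : Fin 2 → Fin 2 → ℝ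

namespace ISACSystem

variable {M : ℕ} (S : ISACSystem M)

/-- Feasibility for the convex subproblem built at `(y, gy)`. -/
structure SubFeasible (m : DuplexMode) (y : Design M) (gy : Fin 2 → Fin 2 → ℝ)
    (p : SubPoint M) : Prop where
  r_nonneg : ∀ k i, 0 ≤ p.r k i
  g_sign : AuxSign m p.g
  d_sign : AuxSign m p.d
  sinr : ∀ k i, p.r k i ≤ S.sinrSurrogate y p.x k i
  gain : ∀ k i, p.g k i ^ 2 ≤ S.sensGain p.x k i
  sens : ∀ k i, p.d k i ≤ S.sensSurrogate y gy p.x p.g k i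
  mode : ModeConstraint m p.x
  power : ∀ k, powerExcess p.x k ≤ 0
  schur : ∀ k i, (schurBlock p.x k i).PosSemidef

/-- `p` is a (global) solution of the convex subproblem built at `(y, gy)`. -/
def SubSolution (m : DuplexMode) (y : Design M) (gy : Fin 2 → Fin 2 → ℝ) (p : SubPoint M) : Prop :=
  S.SubFeasible m y gy p ∧
    ∀ q : SubPoint M, S.SubFeasible m y gy q → S.auxObjective q.r q.d ≤ S.auxObjective p.r p.d

/-- `(x t, g t)` are the iterates of the SCA algorithm, run without stopping: it starts at a
feasible `(w, Q, g)`, and each new `(w, Q, g)` comes from a solution of the convex subproblem built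
at the previous one. -/
structure IsSCARun (m : DuplexMode) (x : ℕ → Design M) (g : ℕ → Fin 2 → Fin 2 → ℝ) : Prop where
  init_feasible : IsFeasible m (x 0)
  init_sign : AuxSign m (g 0)
  init_gain : ∀ k i, g 0 k i ^ 2 ≤ S.sensGain (x 0) k i
  step : ∀ t, ∃ r d : Fin 2 → Fin 2 → ℝ,
    S.SubSolution m (x t) (g t) ⟨x (t + 1), r, g (t + 1), d⟩

end ISACSystem

end

/- The subproblem at an iterate `y` maximizes a minorant of the objective of (P) that agrees with it
at `y`. Hence the objective values along the run do not decrease, which keeps the sensing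
information away from `0` when `w < 1`; the gain constraint is then active at the iterates, so the
auxiliary variables converge to the square roots of the limiting gains. Comparing each iterate with
the points of the segment from the previous one to a feasible `z`, and letting first `t → ∞` and
then the step tend to `0`, shows that the objective of (P) does not increase to first order from the
limit towards `z`, because it is tangent to its minorant at the limit. If a received signal vanishes
in the limit, its surrogate SINR may be negative on that segment, which the subproblem forbids; but
the objective is even in the corresponding beam, which contributes nothing to first order.

First-order stationarity over the feasible set becomes the KKT system by Hahn–Banach, as Slater's
condition holds once the positivity constraints of the idle half-intervals are relaxed. The
multipliers `V` can be taken Hermitian because only the Hermitian part of `Q` enters the problem. -/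

noncomputable section

section Duality

theorem exists_pos_on_and_nonpos_on {V : Type*} [AddCommGroup V] [Module ℝ V]
    [TopologicalSpace V] [IsTopologicalAddGroup V] [ContinuousSMul ℝ V] {P T : Set V}
    (hP : Convex ℝ P) (hPo : IsOpen P) (hPs : ∀ c : ℝ, 0 < c → ∀ x ∈ P, c • x ∈ P)
    (hT : Convex ℝ T) (hT₀ : 0 ∈ T) (hPT : Disjoint P T) :
    ∃ ψ : V →L[ℝ] ℝ, (∀ x ∈ P, 0 < ψ x) ∧ ∀ y ∈ T, ψ y ≤ 0 := by
  rcases P.eq_empty_or_nonempty with rfl | ⟨x, hx⟩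
  · exact ⟨0, by simp, by simp⟩
  obtain ⟨φ, u, hφP, hφT⟩ := geometric_hahn_banach_open hP hPo hT hPT
  have hu_nonpos : u ≤ 0 := (hφT 0 hT₀).trans_eq (map_zero φ)
  have hu_nonneg : 0 ≤ u := by
    have hlim : Tendsto (fun c : ℝ => c * φ x) (𝓝[>] 0) (𝓝 0) := by
      simpa using (tendsto_id.mul_const (φ x)).mono_left (nhdsWithin_le_nhds (a := (0 : ℝ)))
    refine le_of_tendsto hlim ?_
    filter_upwards [self_mem_nhdsWithin] with c hc
    simpa using (hφP _ (hPs c hc x hx)).le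
  exact ⟨-φ, fun x hx => neg_pos.2 ((hφP x hx).trans_le hu_nonpos),
    fun y hy => neg_nonpos.2 (hu_nonneg.trans (hφT y hy))⟩

open Pointwise in
theorem smul_mem_interior_pointedCone {V : Type*} [AddCommGroup V] [Module ℝ V]
    [TopologicalSpace V] [ContinuousConstSMul ℝ V] {K : PointedCone ℝ V} {v : V}
    (hv : v ∈ interior (K : Set V)) {c : ℝ} (hc : 0 < c) :
    c • v ∈ interior (K : Set V) := by
  have hcv : c • v ∈ interior (c • (K : Set V)) := by
    rw [interior_smul₀ hc.ne']
    exact Set.smul_mem_smul_set hv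
  refine interior_mono ?_ hcv
  rintro _ ⟨u, hu, rfl⟩
  exact K.smul_mem hc.le hu

variable {E V : Type*} [AddCommGroup E] [Module ℝ E] [AddCommGroup V] [Module ℝ V]

/-- `G` is concave on the convex set `C` for the preorder in which the cone `K` is the set of
nonnegative vectors. This preorder is not antisymmetric in general, so `ConcaveOn` does not apply.
-/
structure ConeConcaveOn (K : PointedCone ℝ V) (C : Set E) (G : E → V) : Prop where
  convex : Convex ℝ C
  combo_sub_mem : ∀ ⦃x⦄, x ∈ C → ∀ ⦃y⦄, y ∈ C → ∀ ⦃a b : ℝ⦄, 0 ≤ a → 0 ≤ b → a + b = 1 →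
    G (a • x + b • y) - (a • G x + b • G y) ∈ K

variable {K : PointedCone ℝ V} {C : Set E} {f : E → ℝ} {G : E → V}

theorem ConeConcaveOn.convex_hypograph (hG : ConeConcaveOn K C G) (hf : ConcaveOn ℝ C f) :
    Convex ℝ {p : ℝ × V | ∃ x ∈ C, p.1 ≤ f x ∧ G x - p.2 ∈ K} := by
  rintro p ⟨x, hx, hpx, hGx⟩ q ⟨y, hy, hqy, hGy⟩ a b ha hb hab
  refine ⟨a • x + b • y, hG.convex hx hy ha hb hab, ?_, ?_⟩
  · calc a • p.1 + b • q.1 ≤ a • f x + b • f y := by gcongr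
      _ ≤ f (a • x + b • y) := hf.2 hx hy ha hb hab
  · convert K.add_mem (hG.combo_sub_mem hx hy ha hb hab)
      (K.add_mem (K.smul_mem ha hGx) (K.smul_mem hb hGy)) using 1
    simp only [Prod.snd_add, Prod.smul_snd, smul_sub]
    abel

variable [TopologicalSpace V] [IsTopologicalAddGroup V] [ContinuousSMul ℝ V]

theorem exists_pos_coeff_of_slater (hG : ConeConcaveOn K C G) (hf : ConcaveOn ℝ C f)
    {x₀ x₁ : E} (hx₀ : x₀ ∈ C) (hGx₀ : G x₀ ∈ K) (hx₁ : x₁ ∈ C)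
    (hGx₁ : G x₁ ∈ interior (K : Set V)) (hmax : ∀ x ∈ C, G x ∈ K → f x ≤ f x₀) :
    ∃ (a : ℝ) (μ : V →L[ℝ] ℝ), 0 < a ∧ (∀ v ∈ K, 0 ≤ μ v) ∧
      ∀ x ∈ C, a * (f x - f x₀) + μ (G x) ≤ 0 := by
  set P : Set (ℝ × V) := Set.Ioi 0 ×ˢ interior (K : Set V)
  set T : Set (ℝ × V) := {p | ∃ x ∈ C, p.1 ≤ f x - f x₀ ∧ G x - p.2 ∈ K}
  have hPT : Disjoint P T := by
    rw [Set.disjoint_left]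
    rintro ⟨r, v⟩ ⟨hr, hv⟩ ⟨x, hx, hrx, hvx⟩
    have hGx : G x ∈ K := by simpa using K.add_mem hvx (interior_subset hv)
    exact (hr.trans_le hrx).not_ge (sub_nonpos.2 (hmax x hx hGx))
  obtain ⟨ψ, hψP, hψT⟩ := exists_pos_on_and_nonpos_on
    ((convex_Ioi 0).prod K.convex.interior) (isOpen_Ioi.prod isOpen_interior)
    (fun c hc p hp => ⟨mul_pos hc hp.1, smul_mem_interior_pointedCone hp.2 hc⟩)
    (hG.convex_hypograph (hf.sub (convexOn_const _ hG.convex)))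
    ⟨x₀, hx₀, by simp, by simpa using hGx₀⟩ hPT
  have hψ (r : ℝ) (v : V) : ψ (r, v) = r * ψ (1, 0) + ψ (0, v) := by
    rw [← smul_eq_mul, ← map_smul, ← map_add]
    simp
  have hψ_nonneg : ∀ p ∈ Set.Ici (0 : ℝ) ×ˢ (K : Set V), 0 ≤ ψ p := by
    have hcl : Set.Ici (0 : ℝ) ×ˢ (K : Set V) ⊆ closure P := by
      rw [closure_prod_eq, closure_Ioi,
        K.convex.closure_interior_eq_closure_of_nonempty_interior ⟨_, hGx₁⟩]
      exact Set.prod_mono_right subset_closure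
    exact fun p hp => closure_minimal (fun q hq => (hψP q hq).le)
      (isClosed_Ici.preimage ψ.continuous) (hcl hp)
  have hlag (x : E) (hx : x ∈ C) : (f x - f x₀) * ψ (1, 0) + ψ (0, G x) ≤ 0 :=
    (hψ _ _).symm.trans_le (hψT _ ⟨x, hx, le_rfl, by simp⟩)
  have hpos : 0 < ψ (1, 0) := by
    refine (hψ_nonneg (1, 0) ⟨zero_le_one' ℝ, K.zero_mem⟩).lt_of_ne fun h => ?_
    have hslater := hψP (1, G x₁) ⟨Set.mem_Ioi.2 one_pos, hGx₁⟩
    rw [hψ, ← h] at hslater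
    have := hlag x₁ hx₁
    rw [← h] at this
    linarith
  exact ⟨ψ (1, 0), ψ.comp (.inr ℝ ℝ V), hpos,
    fun v hv => hψ_nonneg (0, v) ⟨Set.mem_Ici.2 le_rfl, hv⟩,
    fun x hx => (congrArg (· + ψ (0, G x)) (mul_comm _ _)).trans_le (hlag x hx)⟩

theorem exists_multiplier_of_slater (hG : ConeConcaveOn K C G) (hf : ConcaveOn ℝ C f)
    {x₀ x₁ : E} (hx₀ : x₀ ∈ C) (hGx₀ : G x₀ ∈ K) (hx₁ : x₁ ∈ C)
    (hGx₁ : G x₁ ∈ interior (K : Set V)) (hmax : ∀ x ∈ C, G x ∈ K → f x ≤ f x₀) :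
    ∃ μ : V →L[ℝ] ℝ, (∀ v ∈ K, 0 ≤ μ v) ∧ μ (G x₀) = 0 ∧
      ∀ x ∈ C, f x + μ (G x) ≤ f x₀ := by
  obtain ⟨a, ν, ha, hν, hle⟩ := exists_pos_coeff_of_slater hG hf hx₀ hGx₀ hx₁ hGx₁ hmax
  have hνx₀ : ν (G x₀) = 0 := le_antisymm (by simpa using hle x₀ hx₀) (hν _ hGx₀)
  refine ⟨a⁻¹ • ν, fun v hv => ?_, ?_, fun x hx => ?_⟩
  · exact mul_nonneg (inv_nonneg.2 ha.le) (hν v hv)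
  · simp [hνx₀]
  · have hmul : a * (f x + a⁻¹ * ν (G x)) ≤ a * f x₀ := by
      rw [mul_add, mul_inv_cancel_left₀ ha.ne']
      linarith [hle x hx]
    exact le_of_mul_le_mul_left hmul ha

end Duality

section HermitianForms

theorem re_trace_mul_single {n : Type*} [Fintype n] [DecidableEq n] (U : Matrix n n ℂ) (a b : n)
    (c : ℂ) : (U * Matrix.single a b c).trace.re = (U b a * c).re := by
  simp [Matrix.trace, Matrix.mul_apply, Matrix.single_apply, ite_and]

theorem exists_isHermitian_re_trace_mul {n : Type*} [Fintype n]
    (ν : Matrix n n ℂ →ₗ[ℝ] ℝ) (hν : ∀ Y, ν Yᴴ = ν Y) :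
    ∃ U : Matrix n n ℂ, U.IsHermitian ∧ ∀ Y, ν Y = (U * Y).trace.re := by
  classical
  set U : Matrix n n ℂ := .of fun b a =>
    ⟨ν (Matrix.single a b 1), -ν (Matrix.single a b Complex.I)⟩
  refine ⟨U, ?_, fun Y => ?_⟩
  · ext b a
    have hre : ν (Matrix.single b a 1) = ν (Matrix.single a b 1) := by
      rw [← hν]; simp
    have him : ν (Matrix.single b a Complex.I) = -ν (Matrix.single a b Complex.I) := by
      rw [← hν, ← map_neg]; simp [Matrix.single_neg]
    apply Complex.ext <;> simp [U, Matrix.conjTranspose_apply, hre, him]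
  · have hsingle (a b : n) (c : ℂ) :
        ν (Matrix.single a b c) = (U * Matrix.single a b c).trace.re := by
      have hc : Matrix.single a b c =
          c.re • Matrix.single a b (1 : ℂ) + c.im • Matrix.single a b Complex.I := by
        rw [Matrix.smul_single, Matrix.smul_single, ← Matrix.single_add]
        simp [Complex.re_add_im]
      rw [re_trace_mul_single, hc, map_add, map_smul, map_smul]
      simp [U, mul_comm]
    conv_lhs => rw [Matrix.matrix_eq_sum_single Y]
    conv_rhs => rw [Matrix.matrix_eq_sum_single Y]
    simp only [map_sum, hsingle, Matrix.mul_sum, Matrix.trace_sum, Complex.re_sum]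

theorem star_trace_mul {n : Type*} [Fintype n] (U Y : Matrix n n ℂ) :
    star (U * Y).trace = (Uᴴ * Yᴴ).trace := by
  rw [← Matrix.trace_conjTranspose, Matrix.conjTranspose_mul, Matrix.trace_mul_comm]

theorem im_trace_mul_eq_zero {n : Type*} [Fintype n] {U Y : Matrix n n ℂ} (hU : U.IsHermitian)
    (hY : Y.IsHermitian) : (U * Y).trace.im = 0 :=
  Complex.conj_eq_iff_im.1 <| by rw [← Complex.star_def, star_trace_mul, hU.eq, hY.eq]

theorem re_trace_mul_eq_zero {n : Type*} [Fintype n] {U Y : Matrix n n ℂ} (hU : U.IsHermitian)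
    (hY : Y ∈ skewAdjoint (Matrix n n ℂ)) : (U * Y).trace.re = 0 := by
  have hstar : star (U * Y).trace = -(U * Y).trace := by
    rw [star_trace_mul, hU.eq, ← Matrix.star_eq_conjTranspose, skewAdjoint.mem_iff.1 hY,
      Matrix.mul_neg, Matrix.trace_neg]
  have hre := congrArg Complex.re hstar
  rw [Complex.star_def, Complex.conj_re, Complex.neg_re] at hre
  linarith

variable {M : ℕ}

theorem hermQuad_add (v : Fin M → ℂ) (P Q : Matrix (Fin M) (Fin M) ℂ) :
    hermQuad v (P + Q) = hermQuad v P + hermQuad v Q := by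
  simp [hermQuad, Matrix.add_mulVec]

theorem hermQuad_smul (v : Fin M → ℂ) (c : ℝ) (Q : Matrix (Fin M) (Fin M) ℂ) :
    hermQuad v (c • Q) = c * hermQuad v Q := by
  simp [hermQuad, Matrix.smul_mulVec]

/-- `Q ↦ vᴴ Q v` as a continuous real-linear functional. -/
def hermQuadCLM (v : Fin M → ℂ) : Matrix (Fin M) (Fin M) ℂ →L[ℝ] ℝ :=
  LinearMap.toContinuousLinearMap
    { toFun := hermQuad v
      map_add' := hermQuad_add v
      map_smul' := hermQuad_smul v }

theorem hermQuad_zero (v : Fin M → ℂ) : hermQuad v 0 = 0 := (hermQuadCLM v).map_zero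

theorem hermQuad_sub (v : Fin M → ℂ) (P Q : Matrix (Fin M) (Fin M) ℂ) :
    hermQuad v (P - Q) = hermQuad v P - hermQuad v Q :=
  (hermQuadCLM v).map_sub P Q

@[fun_prop]
theorem continuous_hermQuad (v : Fin M → ℂ) : Continuous (hermQuad v) :=
  (hermQuadCLM v).continuous

@[fun_prop]
theorem differentiable_hermQuad (v : Fin M → ℂ) : Differentiable ℝ (hermQuad v) :=
  (hermQuadCLM v).differentiable

theorem hermQuad_conjTranspose (v : Fin M → ℂ) (Q : Matrix (Fin M) (Fin M) ℂ) :
    hermQuad v Qᴴ = hermQuad v Q := by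
  have hstar : star v ⬝ᵥ (Qᴴ *ᵥ v) = star (star v ⬝ᵥ (Q *ᵥ v)) := by
    rw [Matrix.star_dotProduct, Matrix.star_mulVec, Matrix.dotProduct_mulVec]
    simp
  simp [hermQuad, hstar]

theorem hermQuad_eq_zero_of_mem_skewAdjoint {Q : Matrix (Fin M) (Fin M) ℂ}
    (hQ : Q ∈ skewAdjoint (Matrix (Fin M) (Fin M) ℂ)) (v : Fin M → ℂ) : hermQuad v Q = 0 := by
  have hconj := hermQuad_conjTranspose v Q
  rw [← Matrix.star_eq_conjTranspose, skewAdjoint.mem_iff.1 hQ, ← zero_sub, hermQuad_sub,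
    hermQuad_zero] at hconj
  linarith

theorem hermQuad_vecMulVec (v w : Fin M → ℂ) :
    hermQuad v (Matrix.vecMulVec w (star w)) = ‖star v ⬝ᵥ w‖ ^ 2 := by
  have hstar : star w ⬝ᵥ v = star (star v ⬝ᵥ w) := by rw [Matrix.star_dotProduct]
  rw [hermQuad, Matrix.vecMulVec_mulVec, hstar, dotProduct_smul, MulOpposite.smul_eq_mul_unop,
    MulOpposite.unop_op, Complex.star_def, Complex.mul_conj, Complex.ofReal_re,
    Complex.normSq_eq_norm_sq]

theorem hermQuad_one (v : Fin M → ℂ) : hermQuad v 1 = ∑ a, ‖v a‖ ^ 2 := by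
  simp only [hermQuad, Matrix.one_mulVec, dotProduct, Complex.re_sum]
  refine Finset.sum_congr rfl fun a _ => ?_
  rw [← Complex.normSq_eq_norm_sq, Complex.normSq_apply]
  simp

theorem re_trace_mul_vecMulVec (U : Matrix (Fin M) (Fin M) ℂ) (v : Fin M → ℂ) :
    (U * Matrix.vecMulVec v (star v)).trace.re = hermQuad v U := by
  rw [Matrix.mul_vecMulVec, Matrix.trace_vecMulVec, hermQuad, dotProduct_comm]

theorem posSemidef_iff_hermQuad {Q : Matrix (Fin M) (Fin M) ℂ} :
    Q.PosSemidef ↔ Q.IsHermitian ∧ ∀ v, 0 ≤ hermQuad v Q := by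
  rw [Matrix.posSemidef_iff_dotProduct_mulVec]
  refine and_congr_right fun hQ => forall_congr' fun v => ?_
  have him : (star v ⬝ᵥ (Q *ᵥ v)).im = 0 := hQ.im_star_dotProduct_mulVec_self v
  simp [Complex.le_def, hermQuad, him]

theorem abs_hermQuad_le (v : Fin M → ℂ) (E : Matrix (Fin M) (Fin M) ℂ) :
    |hermQuad v E| ≤ ‖E‖ * M * ∑ a, ‖v a‖ ^ 2 := by
  have hentry (a b : Fin M) : ‖star v a * (E a b * v b)‖ ≤ ‖v a‖ * (‖E‖ * ‖v b‖) := by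
    rw [norm_mul, norm_mul, Pi.star_apply, norm_star]
    gcongr
    exact E.norm_entry_le_entrywise_sup_norm
  calc |hermQuad v E| ≤ ‖∑ a, ∑ b, star v a * (E a b * v b)‖ := by
        simpa only [hermQuad, dotProduct, Matrix.mulVec, Finset.mul_sum]
          using Complex.abs_re_le_norm _
    _ ≤ ∑ a, ∑ b, ‖v a‖ * (‖E‖ * ‖v b‖) :=
        norm_sum_le_of_le _ fun a _ => norm_sum_le_of_le _ fun b _ => hentry a b
    _ = ‖E‖ * (∑ a, ‖v a‖) ^ 2 := by
        rw [sq, Finset.sum_mul_sum]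
        simp only [Finset.mul_sum, mul_left_comm]
    _ ≤ ‖E‖ * (M * ∑ a, ‖v a‖ ^ 2) := by
        gcongr
        simpa using sq_sum_le_card_mul_sum_sq (s := Finset.univ) (f := fun a => ‖v a‖)
    _ = ‖E‖ * M * ∑ a, ‖v a‖ ^ 2 := (mul_assoc _ _ _).symm

/-- The accretive matrices, i.e. those with positive semidefinite Hermitian part. Unlike the cone of
positive semidefinite matrices, this cone has interior points among all complex matrices. -/
def accretiveCone (M : ℕ) : PointedCone ℝ (Matrix (Fin M) (Fin M) ℂ) where
  carrier := {Y | ∀ v, 0 ≤ hermQuad v Y}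
  zero_mem' v := (hermQuad_zero v).ge
  add_mem' hY hZ v := (add_nonneg (hY v) (hZ v)).trans_eq (hermQuad_add v _ _).symm
  smul_mem' c Y hY v := (mul_nonneg c.2 (hY v)).trans_eq (hermQuad_smul v c Y).symm

theorem mem_accretiveCone {Y : Matrix (Fin M) (Fin M) ℂ} :
    Y ∈ accretiveCone M ↔ ∀ v, 0 ≤ hermQuad v Y :=
  Iff.rfl

theorem smul_one_mem_interior_accretiveCone {c : ℝ} (hc : 0 < c) :
    c • (1 : Matrix (Fin M) (Fin M) ℂ) ∈
      interior (accretiveCone M : Set (Matrix (Fin M) (Fin M) ℂ)) := by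
  rw [mem_interior_iff_mem_nhds]
  filter_upwards [Metric.ball_mem_nhds _ (show 0 < c / (M + 1) by positivity)] with Y hY
  refine mem_accretiveCone.2 fun v => ?_
  set E := Y - c • (1 : Matrix (Fin M) (Fin M) ℂ)
  have hE : ‖E‖ * M ≤ c := by
    have := (lt_div_iff₀ (by positivity)).1 (mem_ball_iff_norm.1 hY)
    linarith [norm_nonneg E]
  have hvE : |hermQuad v E| ≤ c * ∑ a, ‖v a‖ ^ 2 :=
    (abs_hermQuad_le v E).trans (by gcongr)
  have hvY : hermQuad v Y = c * ∑ a, ‖v a‖ ^ 2 + hermQuad v E := by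
    rw [hermQuad_sub, hermQuad_smul, hermQuad_one]
    ring
  linarith [neg_abs_le (hermQuad v E)]

theorem re_trace_mul_nonneg {U Y : Matrix (Fin M) (Fin M) ℂ} (hU : U.PosSemidef)
    (hY : Y ∈ accretiveCone M) : 0 ≤ (U * Y).trace.re := by
  obtain ⟨r, v, rfl⟩ := Matrix.posSemidef_iff_eq_sum_vecMulVec.1 hU
  rw [Finset.sum_mul, Matrix.trace_sum, Complex.re_sum]
  refine Finset.sum_nonneg fun a _ => ?_
  rw [Matrix.trace_mul_comm, re_trace_mul_vecMulVec]
  exact hY (v a)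

theorem exists_posSemidef_re_trace_mul (ν : Matrix (Fin M) (Fin M) ℂ →ₗ[ℝ] ℝ)
    (hν : ∀ Y ∈ accretiveCone M, 0 ≤ ν Y) :
    ∃ U : Matrix (Fin M) (Fin M) ℂ, U.PosSemidef ∧ ∀ Y, ν Y = (U * Y).trace.re := by
  have hle (Y : Matrix (Fin M) (Fin M) ℂ) : ν Yᴴ ≤ ν Y := by
    have hmem : Y - Yᴴ ∈ accretiveCone M := fun v => by
      rw [hermQuad_sub, hermQuad_conjTranspose, sub_self]
    exact sub_nonneg.1 ((hν _ hmem).trans_eq (map_sub ν Y Yᴴ))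
  obtain ⟨U, hU, hνU⟩ := exists_isHermitian_re_trace_mul ν fun Y =>
    (hle Y).antisymm ((congrArg ν Y.conjTranspose_conjTranspose).symm.trans_le (hle Yᴴ))
  refine ⟨U, posSemidef_iff_hermQuad.2 ⟨hU, fun v => ?_⟩, hνU⟩
  rw [← re_trace_mul_vecMulVec, ← hνU]
  exact hν _ fun u => (sq_nonneg _).trans_eq (hermQuad_vecMulVec u v).symm

end HermitianForms

section Calculus

theorem two_mul_mul_sub_sq_mul_le_sq_div (c g : ℝ) {b : ℝ} (hb : 0 < b) :
    2 * c * g - c ^ 2 * b ≤ g ^ 2 / b := by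
  rw [le_div_iff₀ hb]
  linarith [sq_nonneg (g - c * b)]

theorem hasDerivAt_eq_of_eventuallyLE {f h : ℝ → ℝ} {a f' h' : ℝ} (hf : HasDerivAt f f' a)
    (hh : HasDerivAt h h' a) (hle : f ≤ᶠ[𝓝 a] h) (heq : f a = h a) : f' = h' := by
  have hmin : IsLocalMin (h - f) a := by
    filter_upwards [hle] with x hx
    simpa [heq] using hx
  exact (sub_eq_zero.1 (hmin.hasDerivAt_eq_zero (hh.sub hf))).symm

theorem hasDerivAt_nonpos_of_eventually_le {f : ℝ → ℝ} {a f' : ℝ} (hf : HasDerivAt f f' a)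
    (hle : ∀ᶠ x in 𝓝[>] a, f x ≤ f a) : f' ≤ 0 := by
  refine le_of_tendsto (hasDerivWithinAt_iff_tendsto_slope' (Set.notMem_Ioi.2 le_rfl) |>.1
    hf.hasDerivWithinAt) ?_
  filter_upwards [hle, self_mem_nhdsWithin] with x hx hax
  rw [slope_def_field]
  exact div_nonpos_of_nonpos_of_nonneg (sub_nonpos.2 hx) (sub_nonneg.2 (le_of_lt hax))

variable {E : Type*} [NormedAddCommGroup E] [NormedSpace ℝ E] {f : E → ℝ}

theorem hasDerivAt_comp_lineMap {y : E} (hf : DifferentiableAt ℝ f y) (z : E) :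
    HasDerivAt (fun ε : ℝ => f (AffineMap.lineMap y z ε)) (fderiv ℝ f y (z - y)) 0 :=
  hf.hasFDerivAt.comp_hasDerivAt_of_eq 0 AffineMap.hasDerivAt_lineMap
    (AffineMap.lineMap_apply_zero y z).symm

theorem fderiv_apply_eq_zero_of_even {y v : E} (hf : DifferentiableAt ℝ f y)
    (heven : ∀ ε : ℝ, f (y - ε • v) = f (y + ε • v)) : fderiv ℝ f y v = 0 := by
  have hderiv := hf.hasFDerivAt.hasLineDerivAt v
  have hderiv_neg := hf.hasFDerivAt.hasLineDerivAt (-v)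
  simp only [HasLineDerivAt, smul_neg, ← sub_eq_add_neg, heven, map_neg] at hderiv hderiv_neg
  linarith [hderiv.unique hderiv_neg]

end Calculus

section FeasibleSet

variable {M : ℕ} (m : DuplexMode) (x z : Design M) (k i : Fin 2)

/-- `modeResidual` as a real-linear map. -/
def modeResidualLM : Design M →ₗ[ℝ] Fin 2 → Matrix (Fin M) (Fin M) ℂ where
  toFun x k := modeResidual m x k
  map_add' x z := by
    cases m
    · funext k
      simp only [modeResidual, Prod.snd_add, Pi.add_apply]
      abel
    · rfl
  map_smul' c x := by
    cases m
    · funext k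
      simp only [modeResidual, Prod.smul_snd, Pi.smul_apply, smul_sub, RingHom.id_apply]
    · rfl

theorem mem_ker_modeResidualLM {m : DuplexMode} {x : Design M} :
    x ∈ LinearMap.ker (modeResidualLM m) ↔ ModeConstraint m x :=
  funext_iff

theorem ModeConstraint.eq_zero_of_not_transmits {m : DuplexMode} {x : Design M} {k i : Fin 2}
    (hx : ModeConstraint m x) (hki : ¬ Transmits m k i) : x.2 k i = 0 := by
  cases m
  · exact absurd trivial hki
  · have hi : i = k.rev := by
      simp only [Transmits] at hki
      exact (by decide : ∀ k i : Fin 2, i ≠ k → i = k.rev) k i hki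
    exact hi ▸ hx k

theorem powerExcess_combo {a b : ℝ} (hab : a + b = 1) :
    powerExcess (a • x + b • z) k = a * powerExcess x k + b * powerExcess z k := by
  simp only [powerExcess, Fin.sum_univ_two, Prod.snd_add, Prod.smul_snd, Pi.add_apply,
    Pi.smul_apply, Matrix.trace_add, Matrix.trace_smul, Complex.add_re, Complex.real_smul,
    Complex.re_ofReal_mul]
  linear_combination (2 : ℝ) * hab

theorem hermQuad_sensCov (v : Fin M → ℂ) :
    hermQuad v (sensCov x k i) = hermQuad v (x.2 k i) - ‖star v ⬝ᵥ x.1 k i‖ ^ 2 := by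
  rw [sensCov, hermQuad_sub, hermQuad_vecMulVec]

theorem concaveOn_hermQuad_sensCov (v : Fin M → ℂ) :
    ConcaveOn ℝ Set.univ fun x : Design M => hermQuad v (sensCov x k i) := by
  set q : Design M →ₗ[ℝ] ℝ :=
    (hermQuadCLM v).toLinearMap ∘ₗ .proj i ∘ₗ .proj k ∘ₗ .snd ℝ _ _
  set ℓ : Design M →ₗ[ℝ] ℂ :=
    (dotProductBilin ℝ ℂ (star v)) ∘ₗ .proj i ∘ₗ .proj k ∘ₗ .fst ℝ _ _
  have hsq : ConvexOn ℝ Set.univ fun c : ℂ => ‖c‖ ^ 2 :=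
    convexOn_univ_norm.pow (fun _ _ => norm_nonneg _) 2
  exact ((q.concaveOn convex_univ).sub (hsq.comp_linearMap ℓ)).congr fun x _ =>
    (hermQuad_sensCov x k i v).symm

theorem isHermitian_sensCov_iff : (sensCov x k i).IsHermitian ↔ (x.2 k i).IsHermitian := by
  have hw : (Matrix.vecMulVec (x.1 k i) (star (x.1 k i))).IsHermitian := by
    rw [Matrix.IsHermitian, Matrix.conjTranspose_vecMulVec, star_star]
  exact ⟨fun h => by simpa [sensCov] using h.add hw, fun h => h.sub hw⟩

theorem posSemidef_schurBlock_iff :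
    (schurBlock x k i).PosSemidef ↔ (sensCov x k i).PosSemidef := by
  have : Invertible (1 : Matrix Unit Unit ℂ) := invertibleOne
  have hw : Matrix.replicateCol Unit (x.1 k i) * (1 : Matrix Unit Unit ℂ)⁻¹ *
      (Matrix.replicateCol Unit (x.1 k i))ᴴ = Matrix.vecMulVec (x.1 k i) (star (x.1 k i)) := by
    ext a b
    simp [Matrix.mul_apply, Matrix.vecMulVec_apply]
  rw [schurBlock, Matrix.PosDef.fromBlocks₂₂ _ _ Matrix.PosDef.one, hw, sensCov]

section

variable {m x}

theorem isFeasible_iff : IsFeasible m x ↔ ModeConstraint m x ∧ (∀ k, powerExcess x k ≤ 0) ∧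
    (∀ k i, (x.2 k i).IsHermitian) ∧ ∀ k i v, 0 ≤ hermQuad v (sensCov x k i) := by
  refine ⟨fun h => ⟨h.mode, h.power, fun k i => ?_, fun k i => ?_⟩,
    fun ⟨hmode, hpow, hherm, hquad⟩ => ⟨hmode, hpow, fun k i => ?_⟩⟩
  · exact (isHermitian_sensCov_iff x k i).1 (h.psd k i).isHermitian
  · exact (posSemidef_iff_hermQuad.1 (h.psd k i)).2
  · exact posSemidef_iff_hermQuad.2 ⟨(isHermitian_sensCov_iff x k i).2 (hherm k i), hquad k i⟩

end

variable (M)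

theorem convex_setOf_isFeasible : Convex ℝ {x : Design M | IsFeasible m x} := by
  intro x hx z hz a b ha hb hab
  obtain ⟨hxm, hxp, hxh, hxq⟩ := isFeasible_iff.1 hx
  obtain ⟨hzm, hzp, hzh, hzq⟩ := isFeasible_iff.1 hz
  refine isFeasible_iff.2 ⟨?_, fun k => ?_, fun k i => ?_, fun k i v => ?_⟩
  · rw [← mem_ker_modeResidualLM] at hxm hzm ⊢
    exact add_mem (Submodule.smul_mem _ a hxm) (Submodule.smul_mem _ b hzm)
  · rw [powerExcess_combo x z k hab]
    exact add_nonpos (mul_nonpos_of_nonneg_of_nonpos ha (hxp k))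
      (mul_nonpos_of_nonneg_of_nonpos hb (hzp k))
  · exact ((hxh k i).smul (IsSelfAdjoint.all a)).add ((hzh k i).smul (IsSelfAdjoint.all b))
  · exact (add_nonneg (mul_nonneg ha (hxq k i v)) (mul_nonneg hb (hzq k i v))).trans
      ((concaveOn_hermQuad_sensCov k i v).2 trivial trivial ha hb hab)

theorem isClosed_setOf_isFeasible : IsClosed {x : Design M | IsFeasible m x} := by
  simp only [isFeasible_iff, ModeConstraint, Set.ofPred_and, Set.ofPred_forall]
  refine .inter (isClosed_iInter fun k => isClosed_eq ?_ continuous_const) <|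
    .inter (isClosed_iInter fun k => isClosed_le ?_ continuous_const) <|
    .inter (isClosed_iInter fun k => isClosed_iInter fun i => isClosed_eq ?_ ?_)
      (isClosed_iInter fun k => isClosed_iInter fun i => isClosed_iInter fun v =>
        isClosed_le continuous_const ?_)
  · cases m <;> simp only [modeResidual] <;> fun_prop
  · unfold powerExcess Matrix.trace Matrix.diag
    fun_prop
  · fun_prop
  · fun_prop
  · simp only [hermQuad_sensCov, dotProduct]
    fun_prop

end FeasibleSet

namespace IsFeasible

variable {M : ℕ} {m : DuplexMode} {x : Design M} (hx : IsFeasible m x) (S : ISACSystem M)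
  (k i : Fin 2)
include hx

theorem isHermitian : (x.2 k i).IsHermitian := (isFeasible_iff.1 hx).2.2.1 k i

theorem hermQuad_nonneg (v : Fin M → ℂ) : 0 ≤ hermQuad v (x.2 k i) := by
  have hcov := (isFeasible_iff.1 hx).2.2.2 k i v
  rw [hermQuad_sensCov] at hcov
  exact (sq_nonneg _).trans (sub_nonneg.1 hcov)

theorem one_le_siNoise : 1 ≤ S.siNoise x k i :=
  le_add_of_nonneg_left <|
    mul_nonneg S.rhoSI_pos.le (mul_nonneg S.eta_pos.le (hx.hermQuad_nonneg k i _))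

theorem siNoise_pos : 0 < S.siNoise x k i := one_pos.trans_le (hx.one_le_siNoise S k i)

theorem siNoise_le_interf : S.siNoise x k i ≤ S.interf x k i := by
  rw [ISACSystem.siNoise, ISACSystem.interf, add_assoc]
  exact le_add_of_nonneg_left (mul_nonneg S.rhoS_pos.le (hx.hermQuad_nonneg k i _))

theorem interf_pos : 0 < S.interf x k i :=
  (hx.siNoise_pos S k i).trans_le (hx.siNoise_le_interf S k i)

theorem sensGain_nonneg : 0 ≤ S.sensGain x k i :=
  mul_nonneg (sq_nonneg _) (hx.hermQuad_nonneg k i _)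

theorem sinr_nonneg : 0 ≤ S.sinr x k i :=
  div_nonneg (mul_nonneg S.rhoC_pos.le (sq_nonneg _)) (hx.interf_pos S k i).le

end IsFeasible

theorem AuxSign.sum_pos {m : DuplexMode} {d : Fin 2 → Fin 2 → ℝ} (hd : AuxSign m d) (k : Fin 2) :
    0 < ∑ i, d k i := by
  have htransmits : Transmits m k k := by cases m <;> simp [Transmits]
  exact Finset.sum_pos' (fun i _ => (hd k i).1) ⟨k, Finset.mem_univ _, (hd k k).2 htransmits⟩

namespace ISACSystem

section Components

variable {M : ℕ} (S : ISACSystem M) (y z : Design M) (k i : Fin 2) (ε : ℝ)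

@[fun_prop]
theorem differentiable_siNoise : Differentiable ℝ fun x => S.siNoise x k i := by
  unfold siNoise Phi
  fun_prop

@[fun_prop]
theorem differentiable_interf : Differentiable ℝ fun x => S.interf x k i := by
  unfold interf Phi
  fun_prop

@[fun_prop]
theorem differentiable_sensGain : Differentiable ℝ fun x => S.sensGain x k i := by
  unfold sensGain
  fun_prop

@[fun_prop]
theorem differentiable_signal : Differentiable ℝ fun x => S.signal x k i := by
  unfold signal dotProduct
  fun_prop

theorem siNoise_lineMap : S.siNoise (AffineMap.lineMap y z ε) k i =
    (1 - ε) * S.siNoise y k i + ε * S.siNoise z k i := by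
  simp only [siNoise, Phi, AffineMap.lineMap_apply_module, Prod.snd_add, Prod.smul_snd,
    Pi.add_apply, Pi.smul_apply, hermQuad_add, hermQuad_smul]
  ring

theorem interf_lineMap : S.interf (AffineMap.lineMap y z ε) k i =
    (1 - ε) * S.interf y k i + ε * S.interf z k i := by
  simp only [interf, Phi, AffineMap.lineMap_apply_module, Prod.snd_add, Prod.smul_snd,
    Pi.add_apply, Pi.smul_apply, hermQuad_add, hermQuad_smul]
  ring

theorem sensGain_lineMap : S.sensGain (AffineMap.lineMap y z ε) k i =
    (1 - ε) * S.sensGain y k i + ε * S.sensGain z k i := by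
  simp only [sensGain, AffineMap.lineMap_apply_module, Prod.snd_add, Prod.smul_snd,
    Pi.add_apply, Pi.smul_apply, hermQuad_add, hermQuad_smul]
  ring

theorem signal_lineMap : S.signal (AffineMap.lineMap y z ε) k i =
    (1 - ε : ℝ) * S.signal y k i + ε * S.signal z k i := by
  simp only [signal, AffineMap.lineMap_apply_module, Prod.fst_add, Prod.smul_fst,
    Pi.add_apply, Pi.smul_apply, dotProduct_add, dotProduct_smul, Complex.real_smul]

end Components

section Objective

variable {M : ℕ} (S : ISACSystem M)

theorem crbScale_pos (hw : S.weight < 1) : 0 < (1 - S.weight) * S.mu / (2 * S.rhoS * S.N) :=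
  div_pos (mul_pos (sub_pos.2 hw) S.mu_pos)
    (mul_pos (mul_pos two_pos S.rhoS_pos) (Nat.cast_pos.2 S.N_pos))

theorem crbScale_nonneg : 0 ≤ (1 - S.weight) * S.mu / (2 * S.rhoS * S.N) :=
  div_nonneg (mul_nonneg (sub_nonneg.2 S.weight_le_one) S.mu_pos.le)
    (mul_nonneg (mul_nonneg zero_le_two S.rhoS_pos.le) S.N.cast_nonneg)

theorem objective_eq_auxObjective (x : Design M) :
    S.objective x = S.auxObjective (S.sinr x) fun k i => S.sensGain x k i / S.siNoise x k i := by
  simp only [objective, auxObjective, rate, crb, sensInfo, ← Finset.mul_sum]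
  ring

theorem auxObjective_mono {r r' d d' : Fin 2 → Fin 2 → ℝ} (hr : ∀ k i, 0 ≤ r k i) (hrr' : r ≤ r')
    (hd : S.weight < 1 → (∀ k, 0 < ∑ i, d k i) ∧ d ≤ d') :
    S.auxObjective r d ≤ S.auxObjective r' d' := by
  refine sub_le_sub (mul_le_mul_of_nonneg_left ?_ (div_nonneg S.weight_nonneg zero_le_two)) ?_
  · refine Finset.sum_le_sum fun k _ => Finset.sum_le_sum fun i _ => ?_
    have hpos : 0 < 1 + r k i := add_pos_of_pos_of_nonneg one_pos (hr k i)
    exact Real.logb_le_logb_of_le one_lt_two hpos (add_le_add_right (hrr' k i) 1)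
  · obtain hw | hw := S.weight_le_one.lt_or_eq
    · obtain ⟨hsum, hdd'⟩ := hd hw
      refine mul_le_mul_of_nonneg_left (Finset.sum_le_sum fun k _ => ?_) (S.crbScale_pos hw).le
      exact inv_anti₀ (hsum k) (Finset.sum_le_sum fun i _ => hdd' k i)
    · simp [hw]

theorem auxObjective_lt {r d d' : Fin 2 → Fin 2 → ℝ} (hw : S.weight < 1)
    (hd : ∀ k, 0 < ∑ i, d k i) (hdd' : d ≤ d') {k i : Fin 2} (hlt : d k i < d' k i) :
    S.auxObjective r d < S.auxObjective r d' := by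
  refine sub_lt_sub_left (mul_lt_mul_of_pos_left ?_ (S.crbScale_pos hw)) _
  refine Finset.sum_lt_sum
    (fun k _ => inv_anti₀ (hd k) (Finset.sum_le_sum fun i _ => hdd' k i))
    ⟨k, Finset.mem_univ _, inv_strictAnti₀ (hd k) ?_⟩
  exact Finset.sum_lt_sum (fun i _ => hdd' k i) ⟨i, Finset.mem_univ _, hlt⟩

theorem tendsto_auxObjective {α : Type*} {l : Filter α} {r d : α → Fin 2 → Fin 2 → ℝ}
    {r' d' : Fin 2 → Fin 2 → ℝ} (hr : ∀ k i, Tendsto (fun t => r t k i) l (𝓝 (r' k i)))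
    (hr' : ∀ k i, 0 ≤ r' k i)
    (hd : S.weight < 1 → ∀ k i, Tendsto (fun t => d t k i) l (𝓝 (d' k i)))
    (hd' : S.weight < 1 → ∀ k, 0 < ∑ i, d' k i) :
    Tendsto (fun t => S.auxObjective (r t) (d t)) l (𝓝 (S.auxObjective r' d')) := by
  refine .sub (.const_mul _ (tendsto_finsetSum _ fun k _ => tendsto_finsetSum _ fun i _ => ?_)) ?_
  · exact (((hr k i).const_add 1).log (by linarith [hr' k i])).div_const _
  · obtain hw | hw := S.weight_le_one.lt_or_eq
    · exact .const_mul _ (tendsto_finsetSum _ fun k _ =>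
        (tendsto_finsetSum _ fun i _ => hd hw k i).inv₀ (hd' hw k).ne')
    · simp [hw, tendsto_const_nhds]

theorem differentiableAt_auxObjective {E : Type*} [NormedAddCommGroup E] [NormedSpace ℝ E]
    {r d : E → Fin 2 → Fin 2 → ℝ} {e : E}
    (hr : ∀ k i, DifferentiableAt ℝ (fun e => r e k i) e) (hr' : ∀ k i, 0 ≤ r e k i)
    (hd : S.weight < 1 → ∀ k i, DifferentiableAt ℝ (fun e => d e k i) e)
    (hd' : S.weight < 1 → ∀ k, 0 < ∑ i, d e k i) :
    DifferentiableAt ℝ (fun e => S.auxObjective (r e) (d e)) e := by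
  refine .sub (.const_mul (.fun_sum fun k _ => .fun_sum fun i _ => ?_) _) ?_
  · simp only [Real.logb, div_eq_mul_inv]
    exact (((hr k i).const_add 1).log (by linarith [hr' k i])).mul_const _
  · obtain hw | hw := S.weight_le_one.lt_or_eq
    · exact .const_mul (.fun_sum fun k _ =>
        (DifferentiableAt.fun_sum fun i _ => hd hw k i).fun_inv (hd' hw k).ne') _
    · simp [hw]

theorem differentiableAt_sinr {x : Design M} {k i : Fin 2} (hx : 0 < S.interf x k i) :
    DifferentiableAt ℝ (S.sinr · k i) x := by
  have hsignal : DifferentiableAt ℝ (fun x => S.rhoC * ‖S.signal x k i‖ ^ 2) x :=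
    ((S.differentiable_signal k i).differentiableAt.norm_sq ℝ).const_mul _
  simp only [sinr, div_eq_mul_inv]
  exact hsignal.fun_mul ((S.differentiable_interf k i).differentiableAt.fun_inv hx.ne')

theorem differentiableAt_objective {m : DuplexMode} {x : Design M} (hx : IsFeasible m x)
    (hinfo : S.weight < 1 → ∀ k, 0 < S.sensInfo x k) : DifferentiableAt ℝ S.objective x := by
  rw [funext S.objective_eq_auxObjective]
  refine S.differentiableAt_auxObjective (fun k i => ?_) (hx.sinr_nonneg S) (fun _ k i => ?_) hinfo
  · exact S.differentiableAt_sinr (hx.interf_pos S k i)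
  · simp only [div_eq_mul_inv]
    exact (S.differentiable_sensGain k i).differentiableAt.fun_mul
      ((S.differentiable_siNoise k i).differentiableAt.fun_inv (hx.siNoise_pos S k i).ne')

end Objective

section Surrogates

variable {M : ℕ} (S : ISACSystem M) {x y : Design M} {k i : Fin 2}

theorem sinrSurrogate_eq (y x : Design M) (k i : Fin 2) :
    S.sinrSurrogate y x k i = S.rhoC *
      (2 * (star (S.signal y k i) * S.signal x k i).re / S.interf y k i -
        (‖S.signal y k i‖ / S.interf y k i) ^ 2 * S.interf x k i) := by
  rw [sinrSurrogate, norm_div, Complex.norm_real, div_pow, div_pow, Real.norm_eq_abs, sq_abs]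
  ring

theorem sinrSurrogate_le_sinr (hx : 0 < S.interf x k i) (hy : 0 < S.interf y k i) :
    S.sinrSurrogate y x k i ≤ S.sinr x k i := by
  have hre : (star (S.signal y k i) * S.signal x k i).re ≤
      ‖S.signal y k i‖ * ‖S.signal x k i‖ := by
    simpa only [norm_mul, norm_star] using Complex.re_le_norm (star (S.signal y k i) * _)
  rw [sinrSurrogate_eq, sinr, mul_div_assoc S.rhoC]
  refine mul_le_mul_of_nonneg_left ?_ S.rhoC_pos.le
  calc 2 * (star (S.signal y k i) * S.signal x k i).re / S.interf y k i -
        (‖S.signal y k i‖ / S.interf y k i) ^ 2 * S.interf x k i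
      ≤ 2 * (‖S.signal y k i‖ * ‖S.signal x k i‖) / S.interf y k i -
        (‖S.signal y k i‖ / S.interf y k i) ^ 2 * S.interf x k i := by gcongr
    _ = 2 * (‖S.signal y k i‖ / S.interf y k i) * ‖S.signal x k i‖ -
        (‖S.signal y k i‖ / S.interf y k i) ^ 2 * S.interf x k i := by ring
    _ ≤ ‖S.signal x k i‖ ^ 2 / S.interf x k i := two_mul_mul_sub_sq_mul_le_sq_div _ _ hx

theorem sinrSurrogate_self (hy : 0 < S.interf y k i) : S.sinrSurrogate y y k i = S.sinr y k i := by
  have hnorm : (star (S.signal y k i) * S.signal y k i).re = ‖S.signal y k i‖ ^ 2 := by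
    rw [mul_comm, Complex.star_def, Complex.mul_conj, Complex.ofReal_re, Complex.normSq_eq_norm_sq]
  rw [sinrSurrogate_eq, sinr, hnorm]
  field_simp
  ring

theorem sensSurrogate_le_sq_div (gy g : Fin 2 → Fin 2 → ℝ) (hx : 0 < S.siNoise x k i) :
    S.sensSurrogate y gy x g k i ≤ g k i ^ 2 / S.siNoise x k i := by
  rw [sensSurrogate, mul_div_assoc 2]
  exact two_mul_mul_sub_sq_mul_le_sq_div _ _ hx

theorem sensSurrogate_self (g : Fin 2 → Fin 2 → ℝ) (hy : 0 < S.siNoise y k i) :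
    S.sensSurrogate y g y g k i = g k i ^ 2 / S.siNoise y k i := by
  rw [sensSurrogate]
  field_simp
  ring

end Surrogates

end ISACSystem

theorem pos_of_tendsto_of_eventually_inv_le {α : Type*} {l : Filter α} [l.NeBot] {u : α → ℝ}
    {a b : ℝ} (hu : Tendsto u l (𝓝 a)) (hpos : ∀ t, 0 < u t) (hinv : ∀ᶠ t in l, (u t)⁻¹ ≤ b) :
    0 < a := by
  obtain ⟨t, ht⟩ := hinv.exists
  have hb : 0 < b := (inv_pos.2 (hpos t)).trans_le ht
  refine (inv_pos.2 hb).trans_le (ge_of_tendsto hu ?_)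
  filter_upwards [hinv] with t ht using inv_le_of_inv_le₀ (hpos t) ht

theorem AuxSign.mono {m : DuplexMode} {d d' : Fin 2 → Fin 2 → ℝ} (hd : AuxSign m d)
    (hdd' : d ≤ d') : AuxSign m d' := fun k i =>
  ⟨(hd k i).1.trans (hdd' k i), fun hki => ((hd k i).2 hki).trans_le (hdd' k i)⟩

namespace ISACSystem

section Subproblem

variable {M : ℕ} {S : ISACSystem M} {m : DuplexMode} {x y : Design M}
  {g gy : Fin 2 → Fin 2 → ℝ} {k i : Fin 2} {p : SubPoint M}

theorem sensGain_eq_zero_of_not_transmits (hx : IsFeasible m x) (hki : ¬ Transmits m k i) :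
    S.sensGain x k i = 0 := by
  rw [sensGain, hx.mode.eq_zero_of_not_transmits hki, hermQuad_zero, mul_zero]

theorem sq_div_siNoise_le (hx : IsFeasible m x) (hgain : ∀ k i, g k i ^ 2 ≤ S.sensGain x k i) :
    (fun k i => g k i ^ 2 / S.siNoise x k i) ≤ fun k i => S.sensGain x k i / S.siNoise x k i :=
  fun k i => div_le_div_of_nonneg_right (hgain k i) (hx.siNoise_pos S k i).le

theorem auxSign_sq_div_siNoise (hx : IsFeasible m x) (hg : AuxSign m g) :
    AuxSign m fun k i => g k i ^ 2 / S.siNoise x k i := fun k i =>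
  ⟨div_nonneg (sq_nonneg _) (hx.siNoise_pos S k i).le,
    fun hki => div_pos (pow_pos ((hg k i).2 hki) 2) (hx.siNoise_pos S k i)⟩

theorem sensInfo_pos (hx : IsFeasible m x) (hg : AuxSign m g)
    (hgain : ∀ k i, g k i ^ 2 ≤ S.sensGain x k i) : 0 < S.sensInfo x k :=
  ((auxSign_sq_div_siNoise hx hg).mono (sq_div_siNoise_le hx hgain)).sum_pos k

variable (S) in
/-- The objective of the reformulated problem at `(w, Q, g)`, with the auxiliary variables `r` and
`d` at their largest admissible values `γ` and `g² / B`. -/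
def reducedObjective (x : Design M) (g : Fin 2 → Fin 2 → ℝ) : ℝ :=
  S.auxObjective (S.sinr x) fun k i => g k i ^ 2 / S.siNoise x k i

theorem reducedObjective_le_objective (hx : IsFeasible m x) (hg : AuxSign m g)
    (hgain : ∀ k i, g k i ^ 2 ≤ S.sensGain x k i) : S.reducedObjective x g ≤ S.objective x := by
  rw [objective_eq_auxObjective]
  exact S.auxObjective_mono (hx.sinr_nonneg S) le_rfl fun _ =>
    ⟨(auxSign_sq_div_siNoise hx hg).sum_pos, sq_div_siNoise_le hx hgain⟩

theorem subFeasible_self (hx : IsFeasible m x) (hg : AuxSign m g)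
    (hgain : ∀ k i, g k i ^ 2 ≤ S.sensGain x k i) :
    S.SubFeasible m x g ⟨x, S.sinr x, g, fun k i => g k i ^ 2 / S.siNoise x k i⟩ where
  r_nonneg := hx.sinr_nonneg S
  g_sign := hg
  d_sign := auxSign_sq_div_siNoise hx hg
  sinr k i := (S.sinrSurrogate_self (hx.interf_pos S k i)).ge
  gain := hgain
  sens k i := (S.sensSurrogate_self g (hx.siNoise_pos S k i)).ge
  mode := hx.mode
  power := hx.power
  schur k i := (posSemidef_schurBlock_iff x k i).2 (hx.psd k i)

theorem SubFeasible.isFeasible (hp : S.SubFeasible m y gy p) : IsFeasible m p.x :=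
  ⟨hp.mode, hp.power, fun k i => (posSemidef_schurBlock_iff p.x k i).1 (hp.schur k i)⟩

theorem SubFeasible.auxObjective_le_reducedObjective (hp : S.SubFeasible m y gy p)
    (hy : IsFeasible m y) : S.auxObjective p.r p.d ≤ S.reducedObjective p.x p.g := by
  have hx := hp.isFeasible
  refine S.auxObjective_mono hp.r_nonneg (fun k i => ?_) fun _ => ⟨hp.d_sign.sum_pos, fun k i => ?_⟩
  · exact (hp.sinr k i).trans (S.sinrSurrogate_le_sinr (hx.interf_pos S k i) (hy.interf_pos S k i))
  · exact (hp.sens k i).trans (S.sensSurrogate_le_sq_div gy p.g (hx.siNoise_pos S k i))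

variable (S) in
/-- The largest values of the sensing variables `g` that the gain constraints allow. -/
def sqrtGain (x : Design M) (k i : Fin 2) : ℝ := √(S.sensGain x k i)

theorem le_sqrtGain (hgain : ∀ k i, g k i ^ 2 ≤ S.sensGain x k i) : g ≤ S.sqrtGain x :=
  fun k i => Real.le_sqrt_of_sq_le (hgain k i)

variable (S) in
/-- The design `x` with all auxiliary variables of the subproblem at `(y, gy)` as large as its
constraints allow. -/
def saturated (y : Design M) (gy : Fin 2 → Fin 2 → ℝ) (x : Design M) : SubPoint M :=
  ⟨x, S.sinrSurrogate y x, S.sqrtGain x, S.sensSurrogate y gy x (S.sqrtGain x)⟩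

theorem subFeasible_saturated (hx : IsFeasible m x) (hr : ∀ k i, 0 ≤ S.sinrSurrogate y x k i)
    (hd : AuxSign m (S.sensSurrogate y gy x (S.sqrtGain x))) :
    S.SubFeasible m y gy (S.saturated y gy x) where
  r_nonneg := hr
  g_sign k i := by
    refine ⟨Real.sqrt_nonneg _, fun hki => Real.sqrt_pos.2 ?_⟩
    have hpos := ((hd k i).2 hki).trans_le
      (S.sensSurrogate_le_sq_div gy (S.sqrtGain x) (hx.siNoise_pos S k i))
    rwa [sqrtGain, Real.sq_sqrt (hx.sensGain_nonneg S k i),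
      div_pos_iff_of_pos_right (hx.siNoise_pos S k i)] at hpos
  d_sign := hd
  sinr _ _ := le_rfl
  gain k i := (Real.sq_sqrt (hx.sensGain_nonneg S k i)).le
  sens _ _ := le_rfl
  mode := hx.mode
  power := hx.power
  schur k i := (posSemidef_schurBlock_iff x k i).2 (hx.psd k i)

theorem sensSurrogate_mono (hgy : 0 ≤ gy k i) (hy : 0 < S.siNoise y k i)
    {g g' : Fin 2 → Fin 2 → ℝ} (hg : g k i ≤ g' k i) :
    S.sensSurrogate y gy x g k i ≤ S.sensSurrogate y gy x g' k i :=
  sub_le_sub_right (mul_le_mul_of_nonneg_left hg (by positivity)) _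

theorem sensSurrogate_lt (hgy : 0 < gy k i) (hy : 0 < S.siNoise y k i)
    {g g' : Fin 2 → Fin 2 → ℝ} (hg : g k i < g' k i) :
    S.sensSurrogate y gy x g k i < S.sensSurrogate y gy x g' k i :=
  sub_lt_sub_right (mul_lt_mul_of_pos_left hg (by positivity)) _

-- Raising `g` to `√G` keeps the point subfeasible and strictly improves it wherever `g < √G`.
theorem SubSolution.eq_sqrtGain (hp : S.SubSolution m y gy p) (hw : S.weight < 1)
    (hy : IsFeasible m y) (hgy : AuxSign m gy) : p.g = S.sqrtGain p.x := by
  obtain ⟨hfeas, hmax⟩ := hp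
  have hx := hfeas.isFeasible
  have hle : p.g ≤ S.sqrtGain p.x := le_sqrtGain hfeas.gain
  have hd : p.d ≤ S.sensSurrogate y gy p.x (S.sqrtGain p.x) := fun k i => (hfeas.sens k i).trans
    (sensSurrogate_mono (hgy k i).1 (hy.siNoise_pos S k i) (hle k i))
  have hsat := subFeasible_saturated hx (fun k i => (hfeas.r_nonneg k i).trans (hfeas.sinr k i))
    (hfeas.d_sign.mono hd)
  funext k i
  by_cases hki : Transmits m k i
  · refine (hle k i).antisymm (not_lt.1 fun hlt => (hmax _ hsat).not_gt ?_)
    exact (S.auxObjective_mono hfeas.r_nonneg hfeas.sinr fun _ =>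
      ⟨hfeas.d_sign.sum_pos, le_rfl⟩).trans_lt <|
        S.auxObjective_lt hw hfeas.d_sign.sum_pos hd <| (hfeas.sens k i).trans_lt <|
          sensSurrogate_lt ((hgy k i).2 hki) (hy.siNoise_pos S k i) hlt
  · refine (hle k i).antisymm ?_
    rw [sqrtGain, sensGain_eq_zero_of_not_transmits hx hki, Real.sqrt_zero]
    exact (hfeas.g_sign k i).1

end Subproblem

section Run

variable {M : ℕ} {S : ISACSystem M} {m : DuplexMode} {x : ℕ → Design M}
  {g : ℕ → Fin 2 → Fin 2 → ℝ} {xlim : Design M} {k : Fin 2}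

namespace IsSCARun

section

variable (hrun : S.IsSCARun m x g) (t : ℕ)
include hrun

theorem feasible : IsFeasible m (x t) := by
  cases t with
  | zero => exact hrun.init_feasible
  | succ t =>
    obtain ⟨r, d, hp, -⟩ := hrun.step t
    exact hp.isFeasible

theorem auxSign : AuxSign m (g t) := by
  cases t with
  | zero => exact hrun.init_sign
  | succ t =>
    obtain ⟨r, d, hp, -⟩ := hrun.step t
    exact hp.g_sign

theorem sq_le_sensGain : ∀ k i, g t k i ^ 2 ≤ S.sensGain (x t) k i := by
  cases t with
  | zero => exact hrun.init_gain
  | succ t =>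
    obtain ⟨r, d, hp, -⟩ := hrun.step t
    exact hp.gain

theorem eq_sqrtGain (hw : S.weight < 1) : g (t + 1) = S.sqrtGain (x (t + 1)) := by
  obtain ⟨r, d, hp⟩ := hrun.step t
  exact hp.eq_sqrtGain hw (hrun.feasible t) (hrun.auxSign t)

theorem reducedObjective_le_objective : S.reducedObjective (x t) (g t) ≤ S.objective (x t) :=
  ISACSystem.reducedObjective_le_objective (hrun.feasible t) (hrun.auxSign t)
    (hrun.sq_le_sensGain t)

theorem auxObjective_le_reducedObjective_succ {q : SubPoint M}
    (hq : S.SubFeasible m (x t) (g t) q) :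
    S.auxObjective q.r q.d ≤ S.reducedObjective (x (t + 1)) (g (t + 1)) := by
  obtain ⟨r, d, hp, hmax⟩ := hrun.step t
  exact (hmax q hq).trans (hp.auxObjective_le_reducedObjective (hrun.feasible t))

theorem monotone_reducedObjective : Monotone fun t => S.reducedObjective (x t) (g t) :=
  monotone_nat_of_le_succ fun t => by
    have hself := subFeasible_self (hrun.feasible t) (hrun.auxSign t) (hrun.sq_le_sensGain t)
    simpa only [reducedObjective] using hrun.auxObjective_le_reducedObjective_succ t hself

end

end IsSCARun

theorem continuousAt_sensInfo {y : Design M} (hy : IsFeasible m y) (k : Fin 2) :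
    ContinuousAt (S.sensInfo · k) y :=
  tendsto_finsetSum _ fun i _ => ((S.differentiable_sensGain k i).continuous.tendsto y).div
    ((S.differentiable_siNoise k i).continuous.tendsto y) (hy.siNoise_pos S k i).ne'

theorem continuousAt_rate {y : Design M} (hy : IsFeasible m y) (k : Fin 2) :
    ContinuousAt (S.rate · k) y := by
  refine Tendsto.const_mul _ <| tendsto_finsetSum _ fun i _ =>
    .div_const (.log (.const_add 1 ?_) ?_) _
  · exact (S.differentiableAt_sinr (hy.interf_pos S k i)).continuousAt
  · linarith [hy.sinr_nonneg S k i]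

theorem crbScale_mul_inv_sensInfo_le {y : Design M} (hy : ∀ k, 0 < S.sensInfo y k) (k : Fin 2) :
    (1 - S.weight) * S.mu / (2 * S.rhoS * S.N) * (S.sensInfo y k)⁻¹ ≤
      S.weight * ∑ k, S.rate y k - S.objective y := by
  calc _ ≤ (1 - S.weight) * S.mu / (2 * S.rhoS * S.N) * ∑ k, (S.sensInfo y k)⁻¹ := by
        refine mul_le_mul_of_nonneg_left ?_ S.crbScale_nonneg
        exact Finset.single_le_sum (f := fun k => (S.sensInfo y k)⁻¹)
          (fun k _ => (inv_pos.2 (hy k)).le) (Finset.mem_univ k)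
    _ = S.weight * ∑ k, S.rate y k - S.objective y := by
        simp only [objective, crb, ← Finset.mul_sum]
        ring

-- The objective values stay above that of the initial point, so the CRBs stay bounded.
theorem IsSCARun.sensInfo_limit_pos (hrun : S.IsSCARun m x g) (hlim : Tendsto x atTop (𝓝 xlim))
    (hw : S.weight < 1) (k : Fin 2) : 0 < S.sensInfo xlim k := by
  have hfeas := (isClosed_setOf_isFeasible M m).mem_of_tendsto hlim (.of_forall hrun.feasible)
  have hpos (t : ℕ) (k : Fin 2) : 0 < S.sensInfo (x t) k :=
    sensInfo_pos (hrun.feasible t) (hrun.auxSign t) (hrun.sq_le_sensGain t)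
  have hrate : Tendsto (fun t => S.weight * ∑ k, S.rate (x t) k) atTop
      (𝓝 (S.weight * ∑ k, S.rate xlim k)) :=
    .const_mul _ (tendsto_finsetSum _ fun k _ => (continuousAt_rate hfeas k).tendsto.comp hlim)
  refine pos_of_tendsto_of_eventually_inv_le ((continuousAt_sensInfo hfeas k).tendsto.comp hlim)
    (fun t => hpos t k) (b := (S.weight * ∑ k, S.rate xlim k + 1 - S.reducedObjective (x 0) (g 0)) /
      ((1 - S.weight) * S.mu / (2 * S.rhoS * S.N))) ?_
  filter_upwards [hrate.eventually_le_const (lt_add_one _)] with t ht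
  rw [le_div_iff₀' (S.crbScale_pos hw)]
  calc _ ≤ S.weight * ∑ k, S.rate (x t) k - S.objective (x t) :=
        crbScale_mul_inv_sensInfo_le (hpos t) k
    _ ≤ _ := sub_le_sub ht ((hrun.monotone_reducedObjective t.zero_le).trans
        (hrun.reducedObjective_le_objective t))

end Run

end ISACSystem

namespace ISACSystem

section SurrogateObjective

variable {M : ℕ} {S : ISACSystem M} {m : DuplexMode} {x y z : Design M}
  {gy : Fin 2 → Fin 2 → ℝ} {k i : Fin 2} {ε : ℝ}

section Limits

variable {α : Type*} {l : Filter α} {u v : α → Design M} {gu : α → Fin 2 → Fin 2 → ℝ}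

theorem continuous_sqrtGain (k i : Fin 2) : Continuous fun x => S.sqrtGain x k i :=
  (S.differentiable_sensGain k i).continuous.sqrt

theorem tendsto_sinrSurrogate (hu : Tendsto u l (𝓝 y)) (hv : Tendsto v l (𝓝 x))
    (hy : 0 < S.interf y k i) :
    Tendsto (fun t => S.sinrSurrogate (u t) (v t) k i) l (𝓝 (S.sinrSurrogate y x k i)) := by
  have hsignal := (S.differentiable_signal k i).continuous
  have hinterf := (S.differentiable_interf k i).continuous
  have hsignal_u := (hsignal.tendsto y).comp hu
  have hinterf_u := (hinterf.tendsto y).comp hu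
  have hcorr := (Complex.continuous_re.tendsto _).comp
    (hsignal_u.star.mul ((hsignal.tendsto x).comp hv))
  simp only [sinrSurrogate_eq]
  exact .const_mul _ <| ((hcorr.const_mul 2).div hinterf_u hy.ne').sub <|
    ((hsignal_u.norm.div hinterf_u hy.ne').pow 2).mul ((hinterf.tendsto x).comp hv)

theorem tendsto_sensSurrogate (hu : Tendsto u l (𝓝 y)) (hv : Tendsto v l (𝓝 x))
    (hgu : Tendsto (gu · k i) l (𝓝 (gy k i))) (hy : 0 < S.siNoise y k i) :
    Tendsto (fun t => S.sensSurrogate (u t) (gu t) (v t) (S.sqrtGain (v t)) k i) l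
      (𝓝 (S.sensSurrogate y gy x (S.sqrtGain x) k i)) := by
  have hnoise := (S.differentiable_siNoise k i).continuous
  have hnoise_u := (hnoise.tendsto y).comp hu
  exact (((hgu.const_mul 2).div hnoise_u hy.ne').mul
    (((continuous_sqrtGain k i).tendsto x).comp hv)).sub
      (((hgu.div hnoise_u hy.ne').pow 2).mul ((hnoise.tendsto x).comp hv))

end Limits

theorem sinrSurrogate_eq_zero_of_signal_eq_zero (hy : S.signal y k i = 0) :
    S.sinrSurrogate y x k i = 0 := by
  simp [sinrSurrogate_eq, hy]

theorem sinr_pos_of_signal_ne_zero (hy : 0 < S.interf y k i) (hsig : S.signal y k i ≠ 0) :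
    0 < S.sinr y k i :=
  div_pos (mul_pos S.rhoC_pos (pow_pos (norm_pos_iff.2 hsig) 2)) hy

theorem sensSurrogate_sqrtGain_self (hy : IsFeasible m y) (k i : Fin 2) :
    S.sensSurrogate y (S.sqrtGain y) y (S.sqrtGain y) k i =
      S.sensGain y k i / S.siNoise y k i := by
  rw [sensSurrogate_self S _ (hy.siNoise_pos S k i), sqrtGain,
    Real.sq_sqrt (hy.sensGain_nonneg S k i)]

variable (S) in
/-- The objective of the subproblem at `(y, gy)`, as a function of the design alone: the auxiliary
variables are as large as the constraints allow. -/
def surrogateObjective (y : Design M) (gy : Fin 2 → Fin 2 → ℝ) (x : Design M) : ℝ :=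
  S.auxObjective (S.sinrSurrogate y x) (S.sensSurrogate y gy x (S.sqrtGain x))

theorem surrogateObjective_self (hy : IsFeasible m y) :
    S.surrogateObjective y (S.sqrtGain y) y = S.objective y := by
  rw [objective_eq_auxObjective, surrogateObjective]
  congr 1
  · funext k i
    exact S.sinrSurrogate_self (hy.interf_pos S k i)
  · funext k i
    exact sensSurrogate_sqrtGain_self hy k i

theorem sensGain_pos_of_transmits (hy : IsFeasible m y) (hinfo : 0 < S.sensInfo y k)
    (hki : Transmits m k i) : 0 < S.sensGain y k i := by
  refine (hy.sensGain_nonneg S k i).lt_of_ne fun hzero => hinfo.ne' ?_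
  refine Finset.sum_eq_zero fun j _ => div_eq_zero_iff.2 (.inl ?_)
  cases m
  · have hcov : y.2 k 0 = y.2 k 1 := sub_eq_zero.1 (hy.mode k)
    have hij : y.2 k j = y.2 k i := by
      fin_cases i <;> fin_cases j <;> simp [hcov]
    rw [hzero, sensGain, sensGain, hij]
  · by_cases hkj : j = k
    · rw [hzero, hkj, show i = k from hki]
    · exact sensGain_eq_zero_of_not_transmits hy hkj

theorem differentiable_sinrSurrogate (y : Design M) (k i : Fin 2) :
    Differentiable ℝ fun x => S.sinrSurrogate y x k i := by
  have : Differentiable ℝ fun x => (star (S.signal y k i) * S.signal x k i).re :=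
    Complex.reCLM.differentiable.comp ((S.differentiable_signal k i).const_mul _)
  simp only [sinrSurrogate, div_eq_mul_inv]
  fun_prop

theorem differentiableAt_sensSurrogate_sqrtGain (y : Design M) (k i : Fin 2) :
    DifferentiableAt ℝ (fun x => S.sensSurrogate y (S.sqrtGain y) x (S.sqrtGain x) k i) y := by
  by_cases hzero : S.sensGain y k i = 0
  · simp [sensSurrogate, sqrtGain, hzero]
  · have : DifferentiableAt ℝ (fun x => √(S.sensGain x k i)) y :=
      (S.differentiable_sensGain k i y).sqrt hzero
    unfold sensSurrogate sqrtGain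
    fun_prop

theorem differentiableAt_surrogateObjective (hy : IsFeasible m y)
    (hinfo : S.weight < 1 → ∀ k, 0 < S.sensInfo y k) :
    DifferentiableAt ℝ (S.surrogateObjective y (S.sqrtGain y)) y := by
  refine S.differentiableAt_auxObjective (fun k i => differentiable_sinrSurrogate y k i y)
    (fun k i => ?_) (fun _ k i => differentiableAt_sensSurrogate_sqrtGain y k i) fun hw k => ?_
  · rw [S.sinrSurrogate_self (hy.interf_pos S k i)]
    exact hy.sinr_nonneg S k i
  · simp only [sensSurrogate_sqrtGain_self hy]
    exact hinfo hw k

section NearBasePoint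

variable {α : Type*} {l : Filter α} {v : α → Design M}

theorem eventually_sinrSurrogate_pos (hy : IsFeasible m y) (hv : Tendsto v l (𝓝 y))
    (hsig : S.signal y k i ≠ 0) : ∀ᶠ a in l, 0 < S.sinrSurrogate y (v a) k i := by
  refine (tendsto_sinrSurrogate tendsto_const_nhds hv (hy.interf_pos S k i)).eventually_const_lt ?_
  rw [S.sinrSurrogate_self (hy.interf_pos S k i)]
  exact sinr_pos_of_signal_ne_zero (hy.interf_pos S k i) hsig

theorem eventually_sinrSurrogate_nonneg (hy : IsFeasible m y) (hv : Tendsto v l (𝓝 y))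
    (k i : Fin 2) : ∀ᶠ a in l, 0 ≤ S.sinrSurrogate y (v a) k i := by
  by_cases hsig : S.signal y k i = 0
  · exact .of_forall fun a => (sinrSurrogate_eq_zero_of_signal_eq_zero hsig).ge
  · exact (eventually_sinrSurrogate_pos hy hv hsig).mono fun _ => le_of_lt

theorem eventually_sum_sensSurrogate_pos (hy : IsFeasible m y) (hv : Tendsto v l (𝓝 y))
    (hinfo : 0 < S.sensInfo y k) :
    ∀ᶠ a in l, 0 < ∑ i, S.sensSurrogate y (S.sqrtGain y) (v a) (S.sqrtGain (v a)) k i := by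
  refine (tendsto_finsetSum _ fun i _ => tendsto_sensSurrogate tendsto_const_nhds hv
    tendsto_const_nhds (hy.siNoise_pos S k i)).eventually_const_lt ?_
  simp only [sensSurrogate_sqrtGain_self hy]
  exact hinfo

end NearBasePoint

theorem tendsto_lineMap_nhds_zero (y z : Design M) :
    Tendsto (AffineMap.lineMap (k := ℝ) y z) (𝓝 0) (𝓝 y) := by
  simpa using (AffineMap.lineMap_continuous (R := ℝ) (p := y) (q := z)).tendsto 0

theorem eventually_sensGain_lineMap_nonneg (hy : IsFeasible m y) (hz : IsFeasible m z)
    (hinfo : 0 < S.sensInfo y k) (i : Fin 2) :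
    ∀ᶠ ε in 𝓝 (0 : ℝ), 0 ≤ S.sensGain (AffineMap.lineMap y z ε) k i := by
  by_cases hki : Transmits m k i
  · exact ((((S.differentiable_sensGain k i).continuous.tendsto y).comp
      (tendsto_lineMap_nhds_zero y z)).eventually_const_lt
        (sensGain_pos_of_transmits hy hinfo hki)).mono fun _ => le_of_lt
  · refine .of_forall fun ε => ?_
    rw [sensGain_lineMap, sensGain_eq_zero_of_not_transmits hy hki,
      sensGain_eq_zero_of_not_transmits hz hki]
    simp

theorem eventually_surrogateObjective_le (hy : IsFeasible m y) (hz : IsFeasible m z)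
    (hinfo : S.weight < 1 → ∀ k, 0 < S.sensInfo y k) :
    ∀ᶠ ε in 𝓝 (0 : ℝ), S.surrogateObjective y (S.sqrtGain y) (AffineMap.lineMap y z ε) ≤
      S.objective (AffineMap.lineMap y z ε) := by
  have hline := tendsto_lineMap_nhds_zero y z
  have hinterf (k i) : ∀ᶠ ε in 𝓝 (0 : ℝ), 0 < S.interf (AffineMap.lineMap y z ε) k i :=
    (((S.differentiable_interf k i).continuous.tendsto y).comp hline).eventually_const_lt
      (hy.interf_pos S k i)
  have hnoise (k i) : ∀ᶠ ε in 𝓝 (0 : ℝ), 0 < S.siNoise (AffineMap.lineMap y z ε) k i :=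
    (((S.differentiable_siNoise k i).continuous.tendsto y).comp hline).eventually_const_lt
      (hy.siNoise_pos S k i)
  filter_upwards [eventually_all.2 fun k => eventually_all.2 (hinterf k),
    eventually_all.2 fun k => eventually_all.2 (hnoise k),
    eventually_all.2 fun k => eventually_all.2 (eventually_sinrSurrogate_nonneg hy hline k),
    eventually_all.2 fun hw => eventually_all.2 fun k =>
      eventually_sum_sensSurrogate_pos hy hline (hinfo hw k),
    eventually_all.2 fun hw => eventually_all.2 fun k => eventually_all.2
      (eventually_sensGain_lineMap_nonneg hy hz (hinfo hw k))] with ε hinterf hnoise hr hd hgain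
  rw [objective_eq_auxObjective]
  refine S.auxObjective_mono hr
    (fun k i => S.sinrSurrogate_le_sinr (hinterf k i) (hy.interf_pos S k i))
    fun hw => ⟨hd hw, fun k i => ?_⟩
  refine (S.sensSurrogate_le_sq_div _ _ (hnoise k i)).trans_eq ?_
  rw [sqrtGain, Real.sq_sqrt (hgain hw k i)]

theorem fderiv_surrogateObjective_apply_sub (hy : IsFeasible m y) (hz : IsFeasible m z)
    (hinfo : S.weight < 1 → ∀ k, 0 < S.sensInfo y k) :
    fderiv ℝ (S.surrogateObjective y (S.sqrtGain y)) y (z - y) =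
      fderiv ℝ S.objective y (z - y) := by
  refine hasDerivAt_eq_of_eventuallyLE
    (hasDerivAt_comp_lineMap (differentiableAt_surrogateObjective hy hinfo) z)
    (hasDerivAt_comp_lineMap (S.differentiableAt_objective hy hinfo) z)
    (eventually_surrogateObjective_le hy hz hinfo) ?_
  rw [AffineMap.lineMap_apply_zero, surrogateObjective_self hy]

theorem sinrSurrogate_lineMap_nonneg (hy : 0 < S.interf y k i) (hsig : S.signal z k i = 0)
    (hε : ε * S.interf z k i ≤ (1 - ε) * S.interf y k i) :
    0 ≤ S.sinrSurrogate y (AffineMap.lineMap y z ε) k i := by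
  have hcorr : (star (S.signal y k i) * S.signal (AffineMap.lineMap y z ε) k i).re =
      (1 - ε) * ‖S.signal y k i‖ ^ 2 := by
    rw [signal_lineMap, hsig, mul_zero, add_zero, mul_left_comm, mul_comm (star _),
      Complex.star_def, Complex.mul_conj, ← Complex.ofReal_mul, Complex.ofReal_re,
      Complex.normSq_eq_norm_sq]
  have heq : S.sinrSurrogate y (AffineMap.lineMap y z ε) k i =
      S.rhoC * ((‖S.signal y k i‖ / S.interf y k i) ^ 2 *
        ((1 - ε) * S.interf y k i - ε * S.interf z k i)) := by
    rw [sinrSurrogate_eq, hcorr, interf_lineMap]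
    field_simp
    ring
  rw [heq]
  exact mul_nonneg S.rhoC_pos.le (mul_nonneg (sq_nonneg _) (sub_nonneg.2 hε))

theorem one_sub_mul_le_sqrtGain_lineMap (hz : IsFeasible m z)
    (hgain : gy k i ^ 2 ≤ S.sensGain y k i) (hε₀ : 0 ≤ ε) (hε₁ : ε ≤ 1) :
    (1 - ε) * gy k i ≤ S.sqrtGain (AffineMap.lineMap y z ε) k i := by
  refine Real.le_sqrt_of_sq_le ?_
  calc ((1 - ε) * gy k i) ^ 2 = (1 - ε) * ((1 - ε) * gy k i ^ 2) := by ring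
    _ ≤ (1 - ε) * (1 * S.sensGain y k i) := by gcongr; linarith
    _ ≤ (1 - ε) * S.sensGain y k i + ε * S.sensGain z k i := by
      rw [one_mul]
      exact le_add_of_nonneg_right (mul_nonneg hε₀ (hz.sensGain_nonneg S k i))
    _ = S.sensGain (AffineMap.lineMap y z ε) k i := (S.sensGain_lineMap y z k i ε).symm

theorem sensSurrogate_lineMap_pos (hy : 0 < S.siNoise y k i) (hz : IsFeasible m z)
    (hgy : 0 < gy k i) (hgain : gy k i ^ 2 ≤ S.sensGain y k i) (hε₀ : 0 ≤ ε) (hε₁ : ε ≤ 1)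
    (hε : ε * S.siNoise z k i < (1 - ε) * S.siNoise y k i) :
    0 < S.sensSurrogate y gy (AffineMap.lineMap y z ε)
      (S.sqrtGain (AffineMap.lineMap y z ε)) k i := by
  have hsqrt := one_sub_mul_le_sqrtGain_lineMap hz hgain hε₀ hε₁
  calc 0 < (gy k i / S.siNoise y k i) ^ 2 *
        ((1 - ε) * S.siNoise y k i - ε * S.siNoise z k i) :=
        mul_pos (pow_pos (div_pos hgy hy) 2) (sub_pos.2 hε)
    _ = 2 * gy k i / S.siNoise y k i * ((1 - ε) * gy k i) -
        (gy k i / S.siNoise y k i) ^ 2 * S.siNoise (AffineMap.lineMap y z ε) k i := by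
        rw [siNoise_lineMap]
        field_simp
        ring
    _ ≤ _ := by
        rw [sensSurrogate]
        gcongr

end SurrogateObjective

section LimitPoint

variable {M : ℕ} {S : ISACSystem M} {m : DuplexMode} {x : ℕ → Design M}
  {g : ℕ → Fin 2 → Fin 2 → ℝ} {xlim z : Design M} {ε : ℝ}

theorem IsSCARun.auxSign_sensSurrogate_lineMap (hrun : S.IsSCARun m x g) (hz : IsFeasible m z)
    (hε₀ : 0 ≤ ε) (hε₁ : ε ≤ 1) (hε : ∀ k i, ε * S.interf z k i < 1 - ε) (t : ℕ) :
    AuxSign m (S.sensSurrogate (x t) (g t) (AffineMap.lineMap (x t) z ε)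
      (S.sqrtGain (AffineMap.lineMap (x t) z ε))) := fun k i => by
  have hx := hrun.feasible t
  by_cases hki : Transmits m k i
  · have hpos := sensSurrogate_lineMap_pos (hx.siNoise_pos S k i) hz
      ((hrun.auxSign t k i).2 hki) (hrun.sq_le_sensGain t k i) hε₀ hε₁ <|
        calc ε * S.siNoise z k i ≤ ε * S.interf z k i :=
              mul_le_mul_of_nonneg_left (hz.siNoise_le_interf S k i) hε₀
          _ < 1 - ε := hε k i
          _ ≤ (1 - ε) * S.siNoise (x t) k i :=
              le_mul_of_one_le_right (sub_nonneg.2 hε₁) (hx.one_le_siNoise S k i)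
    exact ⟨hpos.le, fun _ => hpos⟩
  · have hg : g t k i = 0 := pow_eq_zero_iff two_ne_zero |>.1 <| le_antisymm
      ((hrun.sq_le_sensGain t k i).trans_eq (sensGain_eq_zero_of_not_transmits hx hki))
      (sq_nonneg _)
    exact ⟨by simp [sensSurrogate, hg], fun h => absurd h hki⟩

theorem IsSCARun.eventually_subFeasible_saturated (hrun : S.IsSCARun m x g)
    (hlim : Tendsto x atTop (𝓝 xlim)) (hz : IsFeasible m z)
    (hsig : ∀ k i, S.signal xlim k i = 0 → S.signal z k i = 0) (hε₀ : 0 ≤ ε) (hε₁ : ε ≤ 1)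
    (hε : ∀ k i, ε * S.interf z k i < 1 - ε)
    (hr : ∀ k i, S.signal xlim k i ≠ 0 →
      0 < S.sinrSurrogate xlim (AffineMap.lineMap xlim z ε) k i) :
    ∀ᶠ t in atTop,
      S.SubFeasible m (x t) (g t) (S.saturated (x t) (g t) (AffineMap.lineMap (x t) z ε)) := by
  have hxlim := (isClosed_setOf_isFeasible M m).mem_of_tendsto hlim (.of_forall hrun.feasible)
  have hr_nonneg (k i) :
      ∀ᶠ t in atTop, 0 ≤ S.sinrSurrogate (x t) (AffineMap.lineMap (x t) z ε) k i := by
    by_cases hzero : S.signal xlim k i = 0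
    · refine .of_forall fun t => sinrSurrogate_lineMap_nonneg ((hrun.feasible t).interf_pos S k i)
        (hsig k i hzero) ((hε k i).le.trans ?_)
      exact le_mul_of_one_le_right (sub_nonneg.2 hε₁) <|
        ((hrun.feasible t).one_le_siNoise S k i).trans ((hrun.feasible t).siNoise_le_interf S k i)
    · exact ((tendsto_sinrSurrogate hlim (hlim.lineMap tendsto_const_nhds tendsto_const_nhds)
        (hxlim.interf_pos S k i)).eventually_const_lt (hr k i hzero)).mono fun _ => le_of_lt
  filter_upwards [eventually_all.2 fun k => eventually_all.2 (hr_nonneg k)] with t ht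
  exact subFeasible_saturated
    ((convex_setOf_isFeasible M m).lineMap_mem (hrun.feasible t) hz ⟨hε₀, hε₁⟩) ht
    (hrun.auxSign_sensSurrogate_lineMap hz hε₀ hε₁ hε t)

theorem IsSCARun.tendsto_sqrtGain (hrun : S.IsSCARun m x g) (hlim : Tendsto x atTop (𝓝 xlim))
    (hw : S.weight < 1) (k i : Fin 2) :
    Tendsto (g · k i) atTop (𝓝 (S.sqrtGain xlim k i)) := by
  rw [← tendsto_add_atTop_iff_nat 1]
  simp only [hrun.eq_sqrtGain _ hw]
  exact ((continuous_sqrtGain k i).tendsto xlim).comp ((tendsto_add_atTop_iff_nat 1).2 hlim)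

theorem IsSCARun.surrogateObjective_le_objective (hrun : S.IsSCARun m x g)
    (hlim : Tendsto x atTop (𝓝 xlim)) {z' : Design M} {v : ℕ → Design M}
    (hv : Tendsto v atTop (𝓝 z'))
    (hsub : ∀ᶠ t in atTop, S.SubFeasible m (x t) (g t) (S.saturated (x t) (g t) (v t)))
    (hd : S.weight < 1 → ∀ k,
      0 < ∑ i, S.sensSurrogate xlim (S.sqrtGain xlim) z' (S.sqrtGain z') k i) :
    S.surrogateObjective xlim (S.sqrtGain xlim) z' ≤ S.objective xlim := by
  have hxlim := (isClosed_setOf_isFeasible M m).mem_of_tendsto hlim (.of_forall hrun.feasible)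
  have hsinr (k i) := tendsto_sinrSurrogate hlim hv (hxlim.interf_pos S k i)
  have hsinr_nonneg (k i) : 0 ≤ S.sinrSurrogate xlim z' k i :=
    ge_of_tendsto (hsinr k i) (hsub.mono fun t ht => ht.r_nonneg k i)
  have hobj : Tendsto (fun t => S.objective (x (t + 1))) atTop (𝓝 (S.objective xlim)) :=
    (S.differentiableAt_objective hxlim fun hw k =>
      hrun.sensInfo_limit_pos hlim hw k).continuousAt.tendsto.comp
        ((tendsto_add_atTop_iff_nat 1).2 hlim)
  refine le_of_tendsto_of_tendsto (S.tendsto_auxObjective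
    (d := fun t => S.sensSurrogate (x t) (g t) (v t) (S.sqrtGain (v t))) hsinr hsinr_nonneg
      (fun hw k i => ?_) hd) hobj (hsub.mono fun t ht => ?_)
  · exact tendsto_sensSurrogate hlim hv (hrun.tendsto_sqrtGain hlim hw k i)
      (hxlim.siNoise_pos S k i)
  · exact (hrun.auxObjective_le_reducedObjective_succ t ht).trans
      (hrun.reducedObjective_le_objective (t + 1))

theorem IsSCARun.eventually_surrogateObjective_lineMap_le (hrun : S.IsSCARun m x g)
    (hlim : Tendsto x atTop (𝓝 xlim)) (hz : IsFeasible m z)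
    (hsig : ∀ k i, S.signal xlim k i = 0 → S.signal z k i = 0) :
    ∀ᶠ ε in 𝓝[>] (0 : ℝ), S.surrogateObjective xlim (S.sqrtGain xlim)
      (AffineMap.lineMap xlim z ε) ≤ S.objective xlim := by
  have hxlim := (isClosed_setOf_isFeasible M m).mem_of_tendsto hlim (.of_forall hrun.feasible)
  have hline := (tendsto_lineMap_nhds_zero xlim z).mono_left (nhdsWithin_le_nhds (s := Set.Ioi 0))
  have hid : Tendsto id (𝓝[>] (0 : ℝ)) (𝓝 0) := nhdsWithin_le_nhds
  have hsmall (c : ℝ) : ∀ᶠ ε in 𝓝[>] (0 : ℝ), ε * c < 1 - ε :=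
    (hid.mul_const c).eventually_lt (hid.const_sub 1) (by simp)
  filter_upwards [self_mem_nhdsWithin, hid.eventually_le_const one_pos,
    eventually_all.2 fun k => eventually_all.2 fun i => hsmall (S.interf z k i),
    eventually_all.2 fun k => eventually_all.2 fun i =>
      eventually_all.2 fun hzero : S.signal xlim k i ≠ 0 =>
        eventually_sinrSurrogate_pos hxlim hline hzero,
    eventually_all.2 fun hw => eventually_all.2 fun k =>
      eventually_sum_sensSurrogate_pos hxlim hline (hrun.sensInfo_limit_pos hlim hw k)]
    with ε hε₀ hε₁ hε hr hd
  exact hrun.surrogateObjective_le_objective hlim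
    (hlim.lineMap tendsto_const_nhds tendsto_const_nhds)
    (hrun.eventually_subFeasible_saturated hlim hz hsig (le_of_lt hε₀) hε₁ hε hr) hd

theorem IsSCARun.fderiv_objective_nonpos_of_signal (hrun : S.IsSCARun m x g)
    (hlim : Tendsto x atTop (𝓝 xlim)) (hz : IsFeasible m z)
    (hsig : ∀ k i, S.signal xlim k i = 0 → S.signal z k i = 0) :
    fderiv ℝ S.objective xlim (z - xlim) ≤ 0 := by
  have hxlim := (isClosed_setOf_isFeasible M m).mem_of_tendsto hlim (.of_forall hrun.feasible)
  have hinfo (hw : S.weight < 1) (k) := hrun.sensInfo_limit_pos hlim hw k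
  rw [← fderiv_surrogateObjective_apply_sub hxlim hz hinfo]
  refine hasDerivAt_nonpos_of_eventually_le
    (hasDerivAt_comp_lineMap (differentiableAt_surrogateObjective hxlim hinfo) z) ?_
  simpa only [AffineMap.lineMap_apply_zero, surrogateObjective_self hxlim] using
    hrun.eventually_surrogateObjective_lineMap_le hlim hz hsig

end LimitPoint

section Symmetry

variable {M : ℕ} {S : ISACSystem M} {m : DuplexMode}

theorem objective_congr {x y : Design M}
    (hquad : ∀ k i v, hermQuad v (x.2 k i) = hermQuad v (y.2 k i))
    (hsig : ∀ k i, ‖S.signal x k i‖ = ‖S.signal y k i‖) : S.objective x = S.objective y := by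
  simp only [objective, rate, crb, sensInfo, sinr, interf, sensGain, siNoise, Phi, hquad, hsig]

theorem fderiv_objective_apply_eq_zero {y v : Design M} (hy : DifferentiableAt ℝ S.objective y)
    (hv : ∀ k i, v.2 k i ∈ skewAdjoint (Matrix (Fin M) (Fin M) ℂ))
    (hsig : ∀ k i, S.signal y k i = 0 ∨ S.signal v k i = 0) : fderiv ℝ S.objective y v = 0 := by
  refine fderiv_apply_eq_zero_of_even hy fun ε => objective_congr (fun k i w => ?_) fun k i => ?_
  · have hquad : hermQuad w (v.2 k i) = 0 := hermQuad_eq_zero_of_mem_skewAdjoint (hv k i) w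
    simp [hermQuad_add, hermQuad_sub, hermQuad_smul, hquad]
  · have hsub : S.signal (y - ε • v) k i = S.signal y k i - ε * S.signal v k i := by
      simp [signal, dotProduct_sub]
    have hadd : S.signal (y + ε • v) k i = S.signal y k i + ε * S.signal v k i := by
      simp [signal, dotProduct_add]
    obtain hzero | hzero := hsig k i <;> simp [hsub, hadd, hzero]

open Classical in
/-- The design `z` with the beams zeroed whose signal vanishes at `y`. -/
def maskBeams (S : ISACSystem M) (y z : Design M) : Design M :=
  (fun k i => if S.signal y k.rev i = 0 then 0 else z.1 k i, z.2)

theorem signal_maskBeams (y z : Design M) (k i : Fin 2) :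
    S.signal (S.maskBeams y z) k i = if S.signal y k i = 0 then 0 else S.signal z k i := by
  have hbeam : (S.maskBeams y z).1 k.rev i = if S.signal y k i = 0 then 0 else z.1 k.rev i := by
    simp only [maskBeams, Fin.rev_rev]
  rw [signal, hbeam]
  split_ifs
  · exact dotProduct_zero _
  · rfl

theorem isFeasible_maskBeams {z : Design M} (hz : IsFeasible m z) (y : Design M) :
    IsFeasible m (S.maskBeams y z) := by
  obtain ⟨hmode, hpower, hherm, hquad⟩ := isFeasible_iff.1 hz
  refine isFeasible_iff.2 ⟨hmode, hpower, hherm, fun k i v => (hquad k i v).trans ?_⟩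
  simp only [hermQuad_sensCov, maskBeams]
  split_ifs <;> simp

theorem IsSCARun.fderiv_objective_nonpos {x : ℕ → Design M} {g : ℕ → Fin 2 → Fin 2 → ℝ}
    {xlim : Design M} (hrun : S.IsSCARun m x g) (hlim : Tendsto x atTop (𝓝 xlim)) {z : Design M}
    (hz : IsFeasible m z) : fderiv ℝ S.objective xlim (z - xlim) ≤ 0 := by
  have hxlim := (isClosed_setOf_isFeasible M m).mem_of_tendsto hlim (.of_forall hrun.feasible)
  have hdiff := S.differentiableAt_objective hxlim fun hw k => hrun.sensInfo_limit_pos hlim hw k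
  have hmask := hrun.fderiv_objective_nonpos_of_signal hlim (isFeasible_maskBeams hz xlim)
    fun k i hzero => by rw [signal_maskBeams, if_pos hzero]
  have hrest : fderiv ℝ S.objective xlim (z - S.maskBeams xlim z) = 0 := by
    refine fderiv_objective_apply_eq_zero hdiff (fun k i => by simp [maskBeams]) fun k i => ?_
    have hsub : S.signal (z - S.maskBeams xlim z) k i =
        S.signal z k i - S.signal (S.maskBeams xlim z) k i := by
      simp [signal, dotProduct_sub]
    by_cases hzero : S.signal xlim k i = 0
    · exact .inl hzero
    · exact .inr (by rw [hsub, signal_maskBeams, if_neg hzero, sub_self])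
  rwa [← sub_add_sub_cancel z (S.maskBeams xlim z) xlim, map_add, hrest, zero_add]

end Symmetry

end ISACSystem

section ConicMultipliers

variable {ι κ : Type*} {M : ℕ}

/-- The product of a nonnegative orthant and cones of accretive matrices: the cone of feasible
values of finitely many scalar and matrix inequality constraints. -/
def constraintCone (ι κ : Type*) (M : ℕ) :
    PointedCone ℝ ((ι → ℝ) × (κ → Matrix (Fin M) (Fin M) ℂ)) :=
  Submodule.prod (Submodule.pi Set.univ fun _ => PointedCone.positive ℝ ℝ)
    (Submodule.pi Set.univ fun _ => accretiveCone M)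

theorem mem_constraintCone {p : (ι → ℝ) × (κ → Matrix (Fin M) (Fin M) ℂ)} :
    p ∈ constraintCone ι κ M ↔ (∀ a, 0 ≤ p.1 a) ∧ ∀ b, p.2 b ∈ accretiveCone M := by
  simp [constraintCone, Submodule.mem_prod, Submodule.mem_pi]

theorem mem_interior_constraintCone [Finite ι] [Finite κ]
    {p : (ι → ℝ) × (κ → Matrix (Fin M) (Fin M) ℂ)} (hscal : ∀ a, 0 < p.1 a)
    (hmat : ∀ b, p.2 b ∈ interior (accretiveCone M : Set (Matrix (Fin M) (Fin M) ℂ))) :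
    p ∈ interior (constraintCone ι κ M : Set _) := by
  have hprod : (constraintCone ι κ M : Set ((ι → ℝ) × (κ → Matrix (Fin M) (Fin M) ℂ))) =
      (Set.univ.pi fun _ => Set.Ici 0) ×ˢ Set.univ.pi fun _ => accretiveCone M := by
    ext q
    simp [mem_constraintCone, Pi.le_def]
  rw [hprod, interior_prod_eq, interior_pi_set Set.finite_univ, interior_pi_set Set.finite_univ]
  simp only [interior_Ici]
  exact ⟨fun a _ => hscal a, fun b _ => hmat b⟩

variable [Fintype ι] [Fintype κ]

theorem exists_multipliers_of_nonneg_on_constraintCone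
    (μ : ((ι → ℝ) × (κ → Matrix (Fin M) (Fin M) ℂ)) →ₗ[ℝ] ℝ)
    (hμ : ∀ p ∈ constraintCone ι κ M, 0 ≤ μ p) :
    ∃ (lam : ι → ℝ) (U : κ → Matrix (Fin M) (Fin M) ℂ), (∀ a, 0 ≤ lam a) ∧
      (∀ b, (U b).PosSemidef) ∧
      ∀ p, μ p = ∑ a, lam a * p.1 a + ∑ b, (U b * p.2 b).trace.re := by
  classical
  let scal (a : ι) : ℝ →ₗ[ℝ] ℝ := μ ∘ₗ .inl ℝ _ _ ∘ₗ .single ℝ (fun _ => ℝ) a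
  let mat (b : κ) : Matrix (Fin M) (Fin M) ℂ →ₗ[ℝ] ℝ :=
    μ ∘ₗ .inr ℝ _ _ ∘ₗ .single ℝ (fun _ => Matrix (Fin M) (Fin M) ℂ) b
  have hscal (a : ι) : 0 ≤ scal a 1 :=
    hμ _ <| mem_constraintCone.2 ⟨fun a' => Pi.single_nonneg (α := fun _ => ℝ).2 zero_le_one a',
      fun _ => zero_mem _⟩
  have hmat (b : κ) (Y) (hY : Y ∈ accretiveCone M) : 0 ≤ mat b Y :=
    hμ _ <| mem_constraintCone.2 ⟨fun _ => le_rfl, fun b' => by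
      obtain rfl | hb := eq_or_ne b' b
      · simpa using hY
      · simp [hb]⟩
  choose U hU hmatU using fun b => exists_posSemidef_re_trace_mul (mat b) (hmat b)
  refine ⟨fun a => scal a 1, U, hscal, hU, fun p => ?_⟩
  have hscal_apply (a : ι) : scal a 1 * p.1 a = scal a (p.1 a) := by
    rw [mul_comm, ← smul_eq_mul, ← map_smul, smul_eq_mul, mul_one]
  have hp : p = ∑ a, (Pi.single a (p.1 a), 0) + ∑ b, (0, Pi.single b (p.2 b)) := by
    ext : 1 <;> simp [Prod.fst_sum, Prod.snd_sum, Finset.univ_sum_single]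
  simp only [hscal_apply, ← hmatU]
  conv_lhs => rw [hp, map_add, map_sum, map_sum]
  rfl

theorem exists_multipliers_of_slater {E : Type*} [AddCommGroup E] [Module ℝ E] {C : Set E}
    {f : E → ℝ} {G : E → (ι → ℝ) × (κ → Matrix (Fin M) (Fin M) ℂ)}
    (hG : ConeConcaveOn (constraintCone ι κ M) C G) (hf : ConcaveOn ℝ C f) {x₀ x₁ : E}
    (hx₀ : x₀ ∈ C) (hGx₀ : G x₀ ∈ constraintCone ι κ M) (hx₁ : x₁ ∈ C)
    (hGx₁ : G x₁ ∈ interior (constraintCone ι κ M : Set _))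
    (hmax : ∀ x ∈ C, G x ∈ constraintCone ι κ M → f x ≤ f x₀) :
    ∃ (lam : ι → ℝ) (U : κ → Matrix (Fin M) (Fin M) ℂ), (∀ a, 0 ≤ lam a) ∧
      (∀ b, (U b).PosSemidef) ∧ (∀ a, lam a * (G x₀).1 a = 0) ∧
      (∀ b, (U b * (G x₀).2 b).trace.re = 0) ∧
      ∀ x ∈ C, f x + (∑ a, lam a * (G x).1 a + ∑ b, (U b * (G x).2 b).trace.re) ≤ f x₀ := by
  obtain ⟨μ, hμ, hμx₀, hle⟩ := exists_multiplier_of_slater hG hf hx₀ hGx₀ hx₁ hGx₁ hmax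
  obtain ⟨lam, U, hlam, hU, hrep⟩ := exists_multipliers_of_nonneg_on_constraintCone μ.toLinearMap hμ
  simp only [ContinuousLinearMap.coe_coe] at hrep
  obtain ⟨hscal, hmat⟩ := mem_constraintCone.1 hGx₀
  have hscal_nonneg (a : ι) (_ : a ∈ Finset.univ) : 0 ≤ lam a * (G x₀).1 a :=
    mul_nonneg (hlam a) (hscal a)
  have hmat_nonneg (b : κ) (_ : b ∈ Finset.univ) : 0 ≤ (U b * (G x₀).2 b).trace.re :=
    re_trace_mul_nonneg (hU b) (hmat b)
  rw [hrep, add_eq_zero_iff_of_nonneg (Finset.sum_nonneg hscal_nonneg)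
    (Finset.sum_nonneg hmat_nonneg), Finset.sum_eq_zero_iff_of_nonneg hscal_nonneg,
    Finset.sum_eq_zero_iff_of_nonneg hmat_nonneg] at hμx₀
  exact ⟨lam, U, hlam, hU, fun a => hμx₀.1 a (Finset.mem_univ a),
    fun b => hμx₀.2 b (Finset.mem_univ b), fun x hx => hrep (G x) ▸ hle x hx⟩

end ConicMultipliers

section ConstraintMap

variable {M : ℕ}

theorem IsFeasible.beam_eq_zero_of_not_transmits {m : DuplexMode} {x : Design M}
    (hx : IsFeasible m x) {k i : Fin 2} (hki : ¬ Transmits m k i) : x.1 k i = 0 := by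
  have hquad := (isFeasible_iff.1 hx).2.2.2 k i (x.1 k i)
  rw [hermQuad_sensCov, hx.mode.eq_zero_of_not_transmits hki, hermQuad_zero, zero_sub,
    neg_nonneg, sq_nonpos_iff, norm_eq_zero] at hquad
  exact dotProduct_star_self_eq_zero.1 hquad

open Classical in
/-- Relaxation of `Q ⪰ w wᴴ` to `Q + 1 ⪰ w wᴴ` in idle half-intervals: there the mode forces
`Q = 0`, so the original constraint has no strictly feasible point. -/
def idleSlack (M : ℕ) (m : DuplexMode) (k i : Fin 2) : Matrix (Fin M) (Fin M) ℂ :=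
  if Transmits m k i then 0 else 1

/-- The inequality constraints, relaxed by `idleSlack`, as a map into the space ordered by
`constraintCone`. -/
def constraintMap (m : DuplexMode) (x : Design M) :
    (Fin 2 → ℝ) × (Fin 2 × Fin 2 → Matrix (Fin M) (Fin M) ℂ) :=
  (fun k => -powerExcess x k, fun p => sensCov x p.1 p.2 + idleSlack M m p.1 p.2)

theorem constraintMap_mem_constraintCone {m : DuplexMode} {x : Design M} (hx : IsFeasible m x) :
    constraintMap m x ∈ constraintCone (Fin 2) (Fin 2 × Fin 2) M := by
  refine mem_constraintCone.2 ⟨fun k => neg_nonneg.2 (hx.power k), fun p => add_mem ?_ ?_⟩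
  · exact (posSemidef_iff_hermQuad.1 (hx.psd p.1 p.2)).2
  · unfold idleSlack
    split_ifs
    · exact zero_mem _
    · simpa using interior_subset (smul_one_mem_interior_accretiveCone (M := M) one_pos)

theorem coneConcaveOn_constraintMap (m : DuplexMode) {C : Set (Design M)} (hC : Convex ℝ C) :
    ConeConcaveOn (constraintCone (Fin 2) (Fin 2 × Fin 2) M) C (constraintMap m) := by
  refine ⟨hC, fun x _ z _ a b ha hb hab => mem_constraintCone.2 ⟨fun k => ?_, fun p v => ?_⟩⟩
  · have hpower := powerExcess_combo x z k hab
    simp only [constraintMap, Prod.fst_sub, Prod.fst_add, Prod.smul_fst, Pi.sub_apply,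
      Pi.add_apply, Pi.smul_apply, smul_eq_mul, hpower]
    linarith
  · have hquad := (concaveOn_hermQuad_sensCov p.1 p.2 v).2 (Set.mem_univ x) (Set.mem_univ z)
      ha hb hab
    simp only [constraintMap, Prod.snd_sub, Prod.snd_add, Prod.smul_snd, Pi.sub_apply,
      Pi.add_apply, Pi.smul_apply, smul_eq_mul, hermQuad_sub, hermQuad_add, hermQuad_smul]
      at hquad ⊢
    linear_combination hquad + hermQuad v (idleSlack M m p.1 p.2) * hab

theorem exists_slater_design (m : DuplexMode) (M : ℕ) :
    ∃ x : Design M, ModeConstraint m x ∧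
      constraintMap m x ∈ interior (constraintCone (Fin 2) (Fin 2 × Fin 2) M : Set _) := by
  classical
  set c : ℝ := (M + 1 : ℝ)⁻¹ / 2
  have hc : 0 < c := by positivity
  set x : Design M := (0, fun k i => if Transmits m k i then c • 1 else 0)
  refine ⟨x, fun k => ?_, mem_interior_constraintCone (fun k => neg_pos.2 ?_) fun p => ?_⟩
  · cases m
    · simp [x, modeResidual, Transmits]
    · have hidle : k.rev ≠ k := by decide +revert
      simp [x, modeResidual, Transmits, hidle]
  · have htrace (i : Fin 2) : (x.2 k i).trace.re ≤ c * M := by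
      by_cases hki : Transmits m k i
      · simp [x, hki, Matrix.trace_smul]
      · simp only [x, hki, if_false, Matrix.trace_zero, Complex.zero_re]
        positivity
    have hcM : c * M < 1 := by
      rw [div_mul_eq_mul_div, inv_mul_eq_div, div_div, div_lt_one (by positivity)]
      linarith [(Nat.cast_nonneg M : (0 : ℝ) ≤ M)]
    rw [powerExcess, Fin.sum_univ_two, Complex.add_re]
    linarith [htrace 0, htrace 1]
  · by_cases hki : Transmits m p.1 p.2
    · simpa [constraintMap, sensCov, idleSlack, x, hki] using
        smul_one_mem_interior_accretiveCone hc
    · simpa [constraintMap, sensCov, idleSlack, x, hki] using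
        smul_one_mem_interior_accretiveCone (M := M) one_pos

end ConstraintMap

section HermitianPart

variable {M : ℕ}

theorem hermQuad_selfAdjointPart (v : Fin M → ℂ) (Q : Matrix (Fin M) (Fin M) ℂ) :
    hermQuad v (selfAdjointPart ℝ Q : Matrix (Fin M) (Fin M) ℂ) = hermQuad v Q := by
  conv_rhs => rw [← StarModule.selfAdjointPart_add_skewAdjointPart ℝ Q, hermQuad_add,
    hermQuad_eq_zero_of_mem_skewAdjoint (skewAdjointPart ℝ Q).2, add_zero]

/-- The design with each covariance replaced by its Hermitian part. -/
def hermitianPart (x : Design M) : Design M := (x.1, fun k i => (selfAdjointPart ℝ (x.2 k i)).1)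

theorem modeResidual_hermitianPart (m : DuplexMode) (x : Design M) (k : Fin 2) :
    modeResidual m (hermitianPart x) k = selfAdjointPart ℝ (modeResidual m x k) := by
  cases m
  · simp [modeResidual, hermitianPart]
  · rfl

theorem sub_hermitianPart_mem_skewAdjoint (x : Design M) (k i : Fin 2) :
    (x - hermitianPart x).2 k i ∈ skewAdjoint (Matrix (Fin M) (Fin M) ℂ) := by
  have hsub : (x - hermitianPart x).2 k i = skewAdjointPart ℝ (x.2 k i) :=
    sub_eq_of_eq_add' (StarModule.selfAdjointPart_add_skewAdjointPart ℝ (x.2 k i)).symm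
  exact hsub ▸ (skewAdjointPart ℝ (x.2 k i)).2

theorem powerExcess_add_of_mem_skewAdjoint (x : Design M) {v : Design M} {k : Fin 2}
    (hv : ∀ i, v.2 k i ∈ skewAdjoint (Matrix (Fin M) (Fin M) ℂ)) :
    powerExcess (x + v) k = powerExcess x k := by
  have htrace (i : Fin 2) : (v.2 k i).trace.re = 0 := by
    simpa using re_trace_mul_eq_zero Matrix.isHermitian_one (hv i)
  simp [powerExcess, Matrix.trace_add, htrace]

theorem powerExcess_hermitianPart (x : Design M) (k : Fin 2) :
    powerExcess (hermitianPart x) k = powerExcess x k := by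
  rw [← powerExcess_add_of_mem_skewAdjoint (hermitianPart x)
    (sub_hermitianPart_mem_skewAdjoint x k), add_sub_cancel]

open Classical in
/-- The Hermitian part of a design without its beams in idle half-intervals. -/
def activePart (m : DuplexMode) (x : Design M) : Design M :=
  (fun k i => if Transmits m k i then x.1 k i else 0, (hermitianPart x).2)

theorem isFeasible_activePart {m : DuplexMode} {x : Design M} (hx : ModeConstraint m x)
    (hGx : constraintMap m x ∈ constraintCone (Fin 2) (Fin 2 × Fin 2) M) :
    IsFeasible m (activePart m x) := by
  obtain ⟨hpower, hcov⟩ := mem_constraintCone.1 hGx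
  refine isFeasible_iff.2 ⟨fun k => ?_, fun k => ?_, fun k i => (selfAdjointPart ℝ (x.2 k i)).2,
    fun k i v => ?_⟩
  · calc modeResidual m (hermitianPart x) k = selfAdjointPart ℝ (modeResidual m x k) :=
        modeResidual_hermitianPart m x k
      _ = 0 := by rw [hx k, map_zero, ZeroMemClass.coe_zero]
  · calc powerExcess (hermitianPart x) k = powerExcess x k := powerExcess_hermitianPart x k
      _ ≤ 0 := neg_nonneg.1 (hpower k)
  · have hQ : hermQuad v ((activePart m x).2 k i) = hermQuad v (x.2 k i) :=
      hermQuad_selfAdjointPart v (x.2 k i)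
    rw [hermQuad_sensCov, hQ]
    by_cases hki : Transmits m k i
    · simpa [constraintMap, idleSlack, activePart, hki, hermQuad_sensCov] using hcov (k, i) v
    · simp [activePart, hki, hx.eq_zero_of_not_transmits hki, hermQuad_zero]

theorem ISACSystem.fderiv_objective_activePart {S : ISACSystem M} {m : DuplexMode}
    {x₀ : Design M} (hx₀ : IsFeasible m x₀) (hdiff : DifferentiableAt ℝ S.objective x₀)
    (x : Design M) :
    fderiv ℝ S.objective x₀ (activePart m x) = fderiv ℝ S.objective x₀ x := by
  refine (sub_eq_zero.1 ?_).symm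
  rw [← map_sub]
  refine S.fderiv_objective_apply_eq_zero hdiff (sub_hermitianPart_mem_skewAdjoint x)
    fun k i => ?_
  by_cases hki : Transmits m k.rev i
  · exact .inr (by simp [signal, activePart, hki])
  · exact .inl (by simp [signal, hx₀.beam_eq_zero_of_not_transmits hki])

end HermitianPart

section ConicPenalty

variable {M : ℕ}

/-- The part of the Lagrangian coming from the power and covariance constraints. -/
def conicPenalty (lam : Fin 2 → ℝ) (U : Fin 2 → Fin 2 → Matrix (Fin M) (Fin M) ℂ)
    (x : Design M) : ℝ :=
  ∑ k, lam k * powerExcess x k - ∑ k, ∑ i, (U k i * sensCov x k i).trace.re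

theorem differentiable_conicPenalty (lam : Fin 2 → ℝ)
    (U : Fin 2 → Fin 2 → Matrix (Fin M) (Fin M) ℂ) : Differentiable ℝ (conicPenalty lam U) := by
  have hre {f : Design M → ℂ} (hf : Differentiable ℝ f) : Differentiable ℝ fun x => (f x).re :=
    Complex.reCLM.differentiable.comp hf
  have hpower (k : Fin 2) : Differentiable ℝ fun x : Design M => powerExcess x k := by
    refine (hre ?_).sub_const 2
    unfold Matrix.trace Matrix.diag
    fun_prop
  have hcov (k i : Fin 2) :
      Differentiable ℝ fun x : Design M => (U k i * sensCov x k i).trace.re := by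
    have (b : Fin M) : Differentiable ℝ fun x : Design M => star (x.1 k i b) :=
      Differentiable.star (by fun_prop)
    refine hre ?_
    simp only [Matrix.trace, Matrix.diag, Matrix.mul_apply, sensCov, Matrix.sub_apply,
      Matrix.vecMulVec_apply, Pi.star_apply]
    fun_prop
  unfold conicPenalty
  fun_prop

theorem conicPenalty_add_of_mem_skewAdjoint (lam : Fin 2 → ℝ)
    {U : Fin 2 → Fin 2 → Matrix (Fin M) (Fin M) ℂ} (hU : ∀ k i, (U k i).IsHermitian)
    (x : Design M) {v : Design M} (hv₁ : v.1 = 0)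
    (hv₂ : ∀ k i, v.2 k i ∈ skewAdjoint (Matrix (Fin M) (Fin M) ℂ)) :
    conicPenalty lam U (x + v) = conicPenalty lam U x := by
  have hcov (k i : Fin 2) :
      (U k i * sensCov (x + v) k i).trace.re = (U k i * sensCov x k i).trace.re := by
    have hadd : sensCov (x + v) k i = sensCov x k i + v.2 k i := by
      simp only [sensCov, Prod.fst_add, Prod.snd_add, Pi.add_apply, hv₁, Pi.zero_apply,
        add_zero]
      abel
    rw [hadd, Matrix.mul_add, Matrix.trace_add, Complex.add_re,
      re_trace_mul_eq_zero (hU k i) (hv₂ k i), add_zero]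
  simp only [conicPenalty, hcov, fun k => powerExcess_add_of_mem_skewAdjoint x (hv₂ k)]

theorem fderiv_conicPenalty_apply_eq_zero (lam : Fin 2 → ℝ)
    {U : Fin 2 → Fin 2 → Matrix (Fin M) (Fin M) ℂ} (hU : ∀ k i, (U k i).IsHermitian)
    (x : Design M) {v : Design M} (hv₁ : v.1 = 0)
    (hv₂ : ∀ k i, v.2 k i ∈ skewAdjoint (Matrix (Fin M) (Fin M) ℂ)) :
    fderiv ℝ (conicPenalty lam U) x v = 0 := by
  have hinv (ε : ℝ) : conicPenalty lam U (x + ε • v) = conicPenalty lam U x :=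
    conicPenalty_add_of_mem_skewAdjoint lam hU x (by simp [hv₁])
      fun k i => skewAdjoint.smul_mem ε (hv₂ k i)
  refine fderiv_apply_eq_zero_of_even (differentiable_conicPenalty lam U x) fun ε => ?_
  rw [sub_eq_add_neg, ← neg_smul, hinv, hinv]

end ConicPenalty

section KKT

variable {M : ℕ} {m : DuplexMode} {x₀ : Design M}

theorem exists_isHermitian_sum_re_trace_mul_modeResidual (ℓ : Design M →ₗ[ℝ] ℝ)
    (hmode : ∀ v, ModeConstraint m v → ℓ v = 0) (hherm : ∀ v, ℓ (hermitianPart v) = ℓ v) :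
    ∃ V : Fin 2 → Matrix (Fin M) (Fin M) ℂ, (∀ k, (V k).IsHermitian) ∧
      ∀ v, ℓ v = ∑ k, (V k * modeResidual m v k).trace.re := by
  obtain ⟨φ, rfl⟩ : ℓ ∈ LinearMap.range (modeResidualLM m).dualMap := by
    rw [LinearMap.range_dualMap_eq_dualAnnihilator_ker, Submodule.mem_dualAnnihilator]
    exact fun v hv => hmode v (mem_ker_modeResidualLM.1 hv)
  have hconj (Y : Matrix (Fin M) (Fin M) ℂ) : selfAdjointPart ℝ Yᴴ = selfAdjointPart ℝ Y :=
    Subtype.ext <| by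
      simp [selfAdjointPart_apply_coe, Matrix.star_eq_conjTranspose, add_comm]
  choose V hV hφV using fun k => exists_isHermitian_re_trace_mul
    (φ ∘ₗ .single ℝ (fun _ => Matrix (Fin M) (Fin M) ℂ) k ∘ₗ
      (selfAdjoint.submodule ℝ (Matrix (Fin M) (Fin M) ℂ)).subtype ∘ₗ selfAdjointPart ℝ)
    fun Y => congrArg (fun Z : selfAdjoint _ => φ (Pi.single k Z.1)) (hconj Y)
  refine ⟨V, hV, fun v => ?_⟩
  calc (modeResidualLM m).dualMap φ v = φ (modeResidualLM m (hermitianPart v)) := (hherm v).symm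
    _ = ∑ k, φ (Pi.single k (modeResidual m (hermitianPart v) k)) := by
        rw [← map_sum, Finset.univ_sum_single]
        rfl
    _ = ∑ k, (V k * modeResidual m v k).trace.re :=
        Finset.sum_congr rfl fun k _ => by
          rw [modeResidual_hermitianPart, ← hφV]
          rfl

theorem exists_multipliers_of_forall_isFeasible_le (hx₀ : IsFeasible m x₀) {L : Design M →ₗ[ℝ] ℝ}
    (hL : ∀ x, L (activePart m x) = L x) (hmax : ∀ z, IsFeasible m z → L z ≤ L x₀) :
    ∃ (lam : Fin 2 → ℝ) (U : Fin 2 → Fin 2 → Matrix (Fin M) (Fin M) ℂ), (∀ k, 0 ≤ lam k) ∧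
      (∀ k i, (U k i).PosSemidef) ∧ (∀ k, lam k * powerExcess x₀ k = 0) ∧
      (∀ k i, (U k i * sensCov x₀ k i).trace.re = 0) ∧
      ∀ x, ModeConstraint m x → L x ≤ L x₀ + conicPenalty lam U x := by
  obtain ⟨x₁, hx₁, hGx₁⟩ := exists_slater_design m M
  have hC : Convex ℝ {x : Design M | ModeConstraint m x} := by
    simp only [← mem_ker_modeResidualLM]
    exact (LinearMap.ker (modeResidualLM m)).convex
  obtain ⟨lam, U, hlam, hU, hlam₀, hU₀, hle⟩ := exists_multipliers_of_slater
    (coneConcaveOn_constraintMap m hC) (L.concaveOn hC) hx₀.mode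
    (constraintMap_mem_constraintCone hx₀) hx₁ hGx₁
    fun x hx hGx => (hL x).symm.trans_le (hmax _ (isFeasible_activePart hx hGx))
  have hslack (k i : Fin 2) : U (k, i) * idleSlack M m k i = 0 := by
    by_cases hki : Transmits m k i
    · simp [idleSlack, hki]
    · have hcov : sensCov x₀ k i = 0 := by
        simp [sensCov, hx₀.mode.eq_zero_of_not_transmits hki,
          hx₀.beam_eq_zero_of_not_transmits hki]
      have hre : (U (k, i)).trace.re = 0 := by
        simpa [constraintMap, hcov, idleSlack, hki] using hU₀ (k, i)
      have him : (U (k, i)).trace.im = 0 := by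
        simpa using im_trace_mul_eq_zero (hU (k, i)).isHermitian Matrix.isHermitian_one
      rw [(hU (k, i)).trace_eq_zero_iff.1 (Complex.ext hre him), Matrix.zero_mul]
  simp only [constraintMap, Matrix.mul_add, hslack, add_zero, mul_neg, neg_eq_zero,
    Fintype.sum_prod_type, Finset.sum_neg_distrib] at hlam₀ hU₀ hle
  refine ⟨lam, fun k i => U (k, i), hlam, fun k i => hU (k, i), hlam₀, fun k i => hU₀ (k, i),
    fun x hx => ?_⟩
  rw [conicPenalty]
  linarith [hle x hx]

theorem fderiv_conicPenalty_apply_eq_of_modeConstraint {lam : Fin 2 → ℝ}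
    {U : Fin 2 → Fin 2 → Matrix (Fin M) (Fin M) ℂ} {L : Design M →ₗ[ℝ] ℝ}
    (hx₀ : ModeConstraint m x₀) (hpen : conicPenalty lam U x₀ = 0)
    (hle : ∀ x, ModeConstraint m x → L x ≤ L x₀ + conicPenalty lam U x) {v : Design M}
    (hv : ModeConstraint m v) : fderiv ℝ (conicPenalty lam U) x₀ v = L v := by
  have hderiv := (differentiable_conicPenalty lam U x₀).hasFDerivAt.hasLineDerivAt v
  refine (hasDerivAt_eq_of_eventuallyLE ((hasDerivAt_id (0 : ℝ)).mul_const (L v)) hderiv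
    (.of_forall fun t => ?_) (by simp [hpen])).symm.trans (one_mul _)
  rw [← mem_ker_modeResidualLM] at hx₀ hv
  have hline := hle (x₀ + t • v)
    (mem_ker_modeResidualLM.1 (add_mem hx₀ (Submodule.smul_mem _ t hv)))
  rw [map_add, map_smul, smul_eq_mul] at hline
  exact le_of_add_le_add_left hline

theorem ISACSystem.isKKTPoint_of_stationary {S : ISACSystem M} (hx₀ : IsFeasible m x₀)
    (hinfo : S.weight < 1 → ∀ k, 0 < S.sensInfo x₀ k)
    (hstat : ∀ z, IsFeasible m z → fderiv ℝ S.objective x₀ (z - x₀) ≤ 0) :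
    S.IsKKTPoint m x₀ := by
  have hdiff := S.differentiableAt_objective hx₀ hinfo
  set L := fderiv ℝ S.objective x₀
  obtain ⟨lam, U, hlam, hU, hlam₀, hU₀, hle⟩ := exists_multipliers_of_forall_isFeasible_le
    (L := L.toLinearMap) hx₀ (fderiv_objective_activePart hx₀ hdiff) fun z hz =>
      sub_nonpos.1 ((map_sub L z x₀).symm.trans_le (hstat z hz))
  set H := fderiv ℝ (conicPenalty lam U) x₀
  have hmode (v : Design M) (hv : ModeConstraint m v) : (L - H) v = 0 :=
    sub_eq_zero.2 (fderiv_conicPenalty_apply_eq_of_modeConstraint hx₀.mode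
      (by simp [conicPenalty, hlam₀, hU₀]) hle hv).symm
  have hherm (v : Design M) : (L - H) (hermitianPart v) = (L - H) v := by
    have hskew := sub_hermitianPart_mem_skewAdjoint v
    have hbeam : (v - hermitianPart v).1 = 0 := sub_self v.1
    refine (sub_eq_zero.1 ?_).symm
    rw [← map_sub, sub_apply,
      fderiv_conicPenalty_apply_eq_zero lam (fun k i => (hU k i).isHermitian) x₀ hbeam hskew,
      S.fderiv_objective_apply_eq_zero hdiff hskew fun k i => .inr (by simp [signal, hbeam]),
      sub_zero]
  obtain ⟨V, hV, hLH⟩ :=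
    exists_isHermitian_sum_re_trace_mul_modeResidual (L - H).toLinearMap hmode hherm
  refine ⟨hx₀, hinfo, lam, U, V, hlam, hU, hV, ?_, hlam₀, fun k i =>
    Complex.ext (hU₀ k i) (im_trace_mul_eq_zero (hU k i).isHermitian (hx₀.psd k i).isHermitian)⟩
  have hlagrangian : S.lagrangian m lam U V =
      fun x => -S.objective x + conicPenalty lam U x + (L - H) x := by
    funext x
    rw [lagrangian, ← hLH, conicPenalty, add_sub_assoc]
    rfl
  rw [hlagrangian]
  refine ((hdiff.hasFDerivAt.neg.add (differentiable_conicPenalty lam U x₀).hasFDerivAt).add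
    (L - H).hasFDerivAt).congr_fderiv ?_
  abel

end KKT

end

theorem proposition1 {M : ℕ} (S : ISACSystem M) (m : DuplexMode)
    (x : ℕ → Design M) (g : ℕ → Fin 2 → Fin 2 → ℝ) (hrun : S.IsSCARun m x g)
    (xlim : Design M) (hlim : Filter.Tendsto x Filter.atTop (nhds xlim)) :
    S.IsKKTPoint m xlim :=
  ISACSystem.isKKTPoint_of_stationary
    ((isClosed_setOf_isFeasible M m).mem_of_tendsto hlim (.of_forall hrun.feasible))
    (fun hw k => hrun.sensInfo_limit_pos hlim hw k)
    fun _ hz => hrun.fderiv_objective_nonpos hlim hz
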